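/- Let $\rho,\mu,J,\delta,\xi,\mu_1,\mu_2,\tau>0$ and $b\neq 0$ with $b^2\le \mu\xi$. Let $f:\mathbb{R}\to\mathbb{R}$ and suppose there are constants $k_0>0$ and $\theta>0$ with $$|f(x)-f(y)|\le k_0\big(|x|^\theta+|y|^\theta\big)|x-y|\qquad\text{for all }x,y\in\mathbb{R},$$ and that $\hat f(x):=\int_0^x f(s)\,ds$ satisfies $0\le \hat f(x)\le f(x)\,x$ for all $x\in\mathbb{R}$. Consider the porous-elastic system with delay on $(0,1)$, in which $z(x,y,t)=\phi_t(x,t-\tau y)$: $$\rho u_{tt}-\mu u_{xx}-b\phi_x=0,$$ $$J\phi_{tt}-\delta\phi_{xx}+bu_x+\xi\phi+\mu_1\phi_t+\mu_2z(x,1,t)+f(\phi)=0,$$ $$\tau z_t+z_y=0,\qquad x,y\in(0,1),\ t>0,$$ with $u=\phi=0$ at $x=0,1$ and $z(x,0,t)=\phi_t(x,t)$. In the energy space $$\mathcal H=H^1_0(0,1)\times L^2(0,1)\times H^1_0(0,1)\times L^2(0,1)\times L^2(0,1;L^2(0,1))$$ it takes the form $\dot U=\mathcal A U+\mathcal F(U)$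 for $U=(u,v,\phi,\psi,z)$ with $v=u_t$, $\psi=\phi_t$, where $$\mathcal A U=\Big(v,\ \tfrac{\mu u_{xx}+b\phi_x}{\rho},\ \psi,\ \tfrac{\delta\phi_{xx}-bu_x-\xi\phi-\mu_1\psi-\mu_2z(\cdot,1)}{J},\ -\tfrac1\tau z_y\Big),\qquad \mathcal F(U)=\big(0,0,0,-\tfrac1J f(\phi),0\big),$$ and $D(\mathcal A)$ consists of the $U$ with $u,\phi\in H^2(0,1)\cap H^1_0(0,1)$, $v,\psi\in H^1_0(0,1)$, $z\in L^2(0,1;H^1(0,1))$ and $z(\cdot,0)=\psi$. A mild solution is a continuous $U:[0,\infty)\to\mathcal H$ with $$U(t)=S(t)U(0)+\int_0^tS(t-s)\mathcal F(U(s))\,ds\qquad (t\ge 0),$$ where $S$ is the $C_0$-semigroup on $\mathcal H$ generated by $\mathcal A$. Let $\eta>0$ satisfy $\tau\mu_2\le\eta\le\tau(2\mu_1-\mu_2)$, and let the energy of a mild solution be $$E(t)=\frac12\int_0^1\big[\rho v^2+J\psi^2+\delta\phi_x^2+\mu u_x^2+2bu_x\phi+\xi\phi^2+2\hat f(\phi)\big]dx+\frac{\eta}{2}\int_0^1\!\int_0^1z^2(x,y,t)\,dy\,dx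 .$$ Assume $\mu_2<\mu_1$ and $\dfrac{\rho}{\mu}=\dfrac{J}{\delta}$. Then there is a constant $\gamma>0$, independent of the solution, such that for every mild solution there is a constant $C>0$ with $$E(t)\le Ce^{-\gamma t}\qquad\text{for all }t\ge 0 .$$ -/

import Mathlib

open MeasureTheory Filter Topology Set
open scoped ContDiff ENNReal

namespace Porous

noncomputable section

/-! ## Function spaces on the unit interval -/

/-- Lebesgue measure on the open interval `(0,1)`. -/
abbrev vol01 : Measure ℝ := (volume : Measure ℝ).restrict (Ioo (0 : ℝ) 1)

/-- The real Hilbert space `L²(0,1)`. -/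
abbrev L2 : Type := Lp ℝ 2 vol01

/-- The space `L²(0,1; L²(0,1))`; the outer variable is `x`, the inner variable is `y`. -/
abbrev L2L2 : Type := Lp L2 2 vol01

/-- Test functions: smooth functions with compact support contained in `(0,1)`. -/
def IsTest (χ : ℝ → ℝ) : Prop :=
  ContDiff ℝ ∞ χ ∧ HasCompactSupport χ ∧ tsupport χ ⊆ Ioo (0 : ℝ) 1

/-- `w` is the weak derivative of `u` on `(0,1)`; thus `∃ w, IsWeakDeriv u w` says `u ∈ H¹(0,1)`. -/
def IsWeakDeriv (u w : L2) : Prop :=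
  ∀ χ : ℝ → ℝ, IsTest χ →
    ∫ x in Ioo (0 : ℝ) 1, u x * deriv χ x = - ∫ x in Ioo (0 : ℝ) 1, w x * χ x

/-- `H¹₀(0,1)`: the closure of the test functions in the `H¹` topology. An element is the pair
`(u, uₓ)` of a function and its weak derivative. The pairs `(χ, χ')` form a linear subspace of
`L² × L²`, so the span only packages them as a subspace. -/
def H10 : Submodule ℝ (L2 × L2) :=
  (Submodule.span ℝ {p : L2 × L2 | ∃ χ : ℝ → ℝ, IsTest χ ∧
    (p.1 : ℝ → ℝ) =ᵐ[vol01] χ ∧ (p.2 : ℝ → ℝ) =ᵐ[vol01] deriv χ}).topologicalClosure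

instance : CompleteSpace H10 :=
  (Submodule.isClosed_topologicalClosure _).completeSpace_coe

/-- The element `w ∈ H¹(0,1)` has the boundary values `w(0) = a` and `w(1) = c`, taken for its
continuous representative on `[0,1]`. -/
def HasBoundaryValues (w : L2) (a c : ℝ) : Prop :=
  ∃ g : ℝ → ℝ, ContinuousOn g (Icc (0 : ℝ) 1) ∧ (w : ℝ → ℝ) =ᵐ[vol01] g ∧ g 0 = a ∧ g 1 = c

/-! ## The porous-elastic system with delay -/

/-- The coefficients of the system. -/
structure Coeffs where
  /-- the coefficient of `uₜₜ` -/
  ρ : ℝ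
  /-- the coefficient of `uₓₓ` -/
  μ : ℝ
  /-- the coefficient of `φₜₜ` -/
  J : ℝ
  /-- the coefficient of `φₓₓ` -/
  δ : ℝ
  /-- the coefficient of `φ` -/
  ξ : ℝ
  /-- the coupling coefficient -/
  b : ℝ
  /-- the coefficient of the damping `φₜ(x,t)` -/
  μ₁ : ℝ
  /-- the coefficient of the delayed damping `φₜ(x,t-τ)` -/
  μ₂ : ℝ
  /-- the time delay -/
  τ : ℝ

/-- The standing assumptions on the coefficients. -/
structure Coeffs.Admissible (P : Coeffs) : Prop where
  hρ : 0 < P.ρ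
  hμ : 0 < P.μ
  hJ : 0 < P.J
  hδ : 0 < P.δ
  hξ : 0 < P.ξ
  hμ₁ : 0 < P.μ₁
  hμ₂ : 0 < P.μ₂
  hτ : 0 < P.τ
  hb : P.b ≠ 0
  hb2 : P.b ^ 2 ≤ P.μ * P.ξ

/-- The energy space `H¹₀ × L² × H¹₀ × L² × L²(0,1;L²)`, with the product topology, which is the
topology of the energy norm. Its elements are the states `(u, v, φ, ψ, z)`. -/
abbrev State : Type := H10 × L2 × H10 × L2 × L2L2

/-- The component `u` of a state `(u, v, φ, ψ, z)`, as a function. -/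
def State.u (U : State) : L2 := (U.1 : L2 × L2).1

/-- The weak derivative `uₓ` of the component `u` of a state `(u, v, φ, ψ, z)`. -/
def State.ux (U : State) : L2 := (U.1 : L2 × L2).2

/-- The component `v` (the velocity `uₜ`) of a state `(u, v, φ, ψ, z)`. -/
def State.v (U : State) : L2 := U.2.1

/-- The component `φ` of a state `(u, v, φ, ψ, z)`, as a function. -/
def State.φ (U : State) : L2 := (U.2.2.1 : L2 × L2).1

/-- The weak derivative `φₓ` of the component `φ` of a state `(u, v, φ, ψ, z)`. -/
def State.φx (U : State) : L2 := (U.2.2.1 : L2 × L2).2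

/-- The component `ψ` (the velocity `φₜ`) of a state `(u, v, φ, ψ, z)`. -/
def State.ψ (U : State) : L2 := U.2.2.2.1

/-- The component `z` (the delay variable) of a state `(u, v, φ, ψ, z)`. -/
def State.z (U : State) : L2L2 := U.2.2.2.2

/-- The graph of the operator `A`: the state `U = (u, v, φ, ψ, z)` lies in the domain, that is,
`u, φ ∈ H² ∩ H¹₀`, `v, ψ ∈ H¹₀`, `z ∈ L²(0,1;H¹(0,1))` and `z(·,0) = ψ`, and `V = A U`, that is,
`V = (v, (μ uₓₓ + b φₓ)/ρ, ψ, (δ φₓₓ - b uₓ - ξ φ - μ₁ ψ - μ₂ z(·,1))/J, -z_y/τ)`. -/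
def OperatorGraph (P : Coeffs) (U V : State) : Prop :=
  ∃ uxx φxx z1 : L2, ∃ zy : L2L2,
    IsWeakDeriv U.ux uxx ∧
    IsWeakDeriv U.φx φxx ∧
    (∀ᵐ x ∂vol01, IsWeakDeriv (U.z x) (zy x)) ∧
    (∀ᵐ x ∂vol01, HasBoundaryValues (U.z x) (U.ψ x) (z1 x)) ∧
    V.u = U.v ∧
    V.v = (P.μ / P.ρ) • uxx + (P.b / P.ρ) • U.φx ∧
    V.φ = U.ψ ∧
    V.ψ = (P.δ / P.J) • φxx - (P.b / P.J) • U.ux - (P.ξ / P.J) • U.φ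
      - (P.μ₁ / P.J) • U.ψ - (P.μ₂ / P.J) • z1 ∧
    V.z = -((1 / P.τ) • zy)

/-- The graph of the nonlinear operator: `W = F(U) = (0, 0, 0, -f(φ)/J, 0)`. -/
def ForcingGraph (P : Coeffs) (f : ℝ → ℝ) (U W : State) : Prop :=
  W.u = 0 ∧ W.ux = 0 ∧ W.v = 0 ∧ W.φ = 0 ∧ W.φx = 0 ∧
    (W.ψ : ℝ → ℝ) =ᵐ[vol01] (fun x => -(1 / P.J) * f (U.φ x)) ∧
    W.z = 0

/-- `S` is a `C₀`-semigroup of bounded operators on the energy space (only the values `S t` with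
`0 ≤ t` are relevant). -/
structure IsC0Semigroup (S : ℝ → State →L[ℝ] State) : Prop where
  zero : S 0 = ContinuousLinearMap.id ℝ State
  add : ∀ s t : ℝ, 0 ≤ s → 0 ≤ t → S (s + t) = (S s).comp (S t)
  tendsto_zero : ∀ U : State, Tendsto (fun t => S t U) (𝓝[>] (0 : ℝ)) (𝓝 U)

/-- The infinitesimal generator of `S` is the operator `A` of the system. -/
def GeneratedByOperator (P : Coeffs) (S : ℝ → State →L[ℝ] State) : Prop :=
  ∀ U V : State,
    Tendsto (fun t : ℝ => t⁻¹ • (S t U - U)) (𝓝[>] (0 : ℝ)) (𝓝 V) ↔ OperatorGraph P U V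

/-- `U : [0,∞) → State` is a (global) mild solution of `U' = A U + F(U)`: it is continuous, and
`U(t) = S(t) U(0) + ∫₀ᵗ S(t-s) F(U(s)) ds` for `t ≥ 0`, where `S` is the `C₀`-semigroup generated
by `A`. Here `G s` is `F(U(s))`. -/
def IsMildSolution (P : Coeffs) (f : ℝ → ℝ) (U : ℝ → State) : Prop :=
  ContinuousOn U (Ici 0) ∧
  ∃ S : ℝ → State →L[ℝ] State, IsC0Semigroup S ∧ GeneratedByOperator P S ∧
  ∃ G : ℝ → State, (∀ s : ℝ, 0 ≤ s → ForcingGraph P f (U s) (G s)) ∧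
    ∀ t : ℝ, 0 ≤ t →
      IntervalIntegrable (fun s => S (t - s) (G s)) volume 0 t ∧
      U t = S t (U 0) + ∫ s in (0 : ℝ)..t, S (t - s) (G s)

/-- The primitive `f̂(x) = ∫₀ˣ f(s) ds`. -/
def primitive (f : ℝ → ℝ) (x : ℝ) : ℝ := ∫ s in (0 : ℝ)..x, f s

/-- The energy of a state `(u, v, φ, ψ, z)`, with weight `η` for the delay variable:
`½ ∫ [ρ v² + J ψ² + δ φₓ² + μ uₓ² + 2 b uₓ φ + ξ φ² + 2 f̂(φ)] dx + (η/2) ∫∫ z² dy dx`. -/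
def energy (P : Coeffs) (f : ℝ → ℝ) (η : ℝ) (U : State) : ℝ :=
  (1 / 2) * (∫ x in Ioo (0 : ℝ) 1,
    (P.ρ * (U.v x) ^ 2 + P.J * (U.ψ x) ^ 2 + P.δ * (U.φx x) ^ 2 + P.μ * (U.ux x) ^ 2
      + 2 * P.b * U.ux x * U.φ x + P.ξ * (U.φ x) ^ 2
      + 2 * primitive f (U.φ x)))
  + (η / 2) * ∫ x in Ioo (0 : ℝ) 1, ∫ y in Ioo (0 : ℝ) 1, (U.z x y) ^ 2

end

end Porous

/-!
# Exponential decay for a porous-elastic system with delayed damping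

The proof is a Lyapunov argument carried out directly on mild solutions.

*The linear system.* If `V = A U` and `B` is a bounded bilinear form on the energy space, then
`B U V + B V U` is the derivative of `B U U` along the linear flow, and integration by parts computes
it. The energy (`energyForm`) loses a multiple of `‖ψ‖² + ‖z(·,1)‖²` because `μ₂ < μ₁`, and the
remaining quantities are recovered by multipliers.
* `phiForm` produces `-‖φₓ‖²`. The coupling `b ∫ uₓ φ` is removed by testing the first equation with
  the primitive `w` of the mean-free part of `φ`, and `b² ≤ μ ξ` gives the result a sign.
* `crossForm` produces `-‖uₓ‖²`; its mixed second-order terms cancel exactly when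
  `ρ / μ = J / δ`. It leaves products of the boundary values of `uₓ` and `φₓ`.
* `uBoundaryForm` and `phiBoundaryForm`, with the weight `1 - 2x`, produce the squares of these
  boundary values with a good sign, which absorb the products.
* `velocityForm` produces `-‖v‖²`, and `delayForm`, with the weight `2 - y`, produces `-‖z‖²`.

A linear combination `lyapForm` of these forms and the energy dissipates the whole energy norm, and
any prescribed multiple of `‖φₓ‖²` can be dissipated in addition (`exists_lyapForm_deriv_le`).

*Mild solutions.* A mild solution need not be differentiable, so only the upper right Dini derivative
of `B (U t) (U t)` is estimated. For initial values in the domain of the generator the estimate is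
differentiation; density of the domain and joint continuity of the semigroup carry the bound
`B U V + B V U ≤ q U`, with `q` continuous, over to all initial values
(`IsSemigroup.eventually_quadratic_le`), and the Duhamel formula adds the contribution of the
forcing (`IsMild.eventually_quadratic_lt`). Comparison with an exponential then needs no regularity
of solutions.

*The nonlinear term.* Adding a multiple of the potential `∫ f̂(φ)` turns `f` into an exact derivative
in the energy, so the total energy does not increase (`Solution.totalEnergy_le`) and bounds
`sup |φ| ≤ ‖φₓ‖` along the solution. On such a bounded range `|f(s)| ≤ K |s|`, so the contributions of
`f` to the other functionals are absorbed by the large multiple of `‖φₓ‖²`, while `f̂(s) ≤ f(s) s`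
makes `phiForm` dissipate the potential. This gives a decay rate depending on a bound for the initial
energy (`Solution.exists_decay`). To obtain a rate independent of the solution, one waits until the
energy is at most `1`, which happens by the first rate, and continues with the rate that belongs to
the bound `1`.

The weight of the delay variable in the functionals is `τ μ₁` throughout; passing to the weight `η` of
the statement costs a constant factor.
-/

namespace Porous

noncomputable section

open scoped InnerProductSpace

/-! ### Strongly continuous semigroups -/

/-- A strongly continuous semigroup of bounded operators on a normed space; the values of `S` at
negative times are irrelevant. -/
structure IsSemigroup {E : Type*} [NormedAddCommGroup E] [NormedSpace ℝ E]
    (S : ℝ → E →L[ℝ] E) : Prop where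
  zero : S 0 = ContinuousLinearMap.id ℝ E
  add : ∀ s t : ℝ, 0 ≤ s → 0 ≤ t → S (s + t) = (S s).comp (S t)
  tendsto_zero : ∀ U : E, Tendsto (fun t => S t U) (𝓝[>] (0 : ℝ)) (𝓝 U)

/-- `V` is the value at `U` of the infinitesimal generator of `S`. -/
def GeneratorGraph {E : Type*} [NormedAddCommGroup E] [NormedSpace ℝ E]
    (S : ℝ → E →L[ℝ] E) (U V : E) : Prop :=
  Tendsto (fun t : ℝ => t⁻¹ • (S t U - U)) (𝓝[>] (0 : ℝ)) (𝓝 V)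

lemma hasDerivWithinAt_Ici_iff_tendsto {E : Type*} [NormedAddCommGroup E] [NormedSpace ℝ E]
    {g : ℝ → E} {g' : E} {r : ℝ} : HasDerivWithinAt g g' (Ici r) r ↔
      Tendsto (fun k : ℝ => k⁻¹ • (g (r + k) - g r)) (𝓝[>] (0 : ℝ)) (𝓝 g') := by
  rw [← hasDerivWithinAt_Ioi_iff_Ici, hasDerivWithinAt_iff_tendsto_slope' (by simp),
    show 𝓝[>] r = map (fun k => r + k) (𝓝[>] (0 : ℝ)) by simp, tendsto_map'_iff]
  simp [Function.comp_def, slope]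

namespace IsSemigroup

variable {E : Type*} [NormedAddCommGroup E] [NormedSpace ℝ E] {S : ℝ → E →L[ℝ] E}

lemma tendsto_zero' (hS : IsSemigroup S) (U : E) :
    Tendsto (fun t => S t U) (𝓝[≥] (0 : ℝ)) (𝓝 U) := by
  have h : (𝓝[≥] (0 : ℝ)) = pure 0 ⊔ 𝓝[>] 0 := by
    rw [← nhdsWithin_singleton, ← nhdsWithin_union, singleton_union, Ioi_insert]
  rw [h, tendsto_sup]
  refine ⟨?_, hS.tendsto_zero U⟩
  rw [tendsto_pure_left]
  intro s hs
  simpa [hS.zero] using mem_of_mem_nhds hs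

/-- The uniform boundedness principle turns strong continuity into a uniform bound near `0`. -/
lemma exists_bound [CompleteSpace E] (hS : IsSemigroup S) :
    ∃ M > 0, ∃ d > 0, ∀ t, 0 ≤ t → t ≤ d → ‖S t‖ ≤ M := by
  by_contra! hcon
  have h1 : ∀ n : ℕ, ∃ t, 0 ≤ t ∧ t ≤ 1 / ((n : ℝ) + 1) ∧ (n : ℝ) + 1 < ‖S t‖ := fun n =>
    hcon (n + 1) (by positivity) _ (by positivity)
  choose t ht0 ht1 ht2 using h1
  have htend : Tendsto t atTop (𝓝[≥] 0) := by
    refine tendsto_nhdsWithin_iff.2 ⟨?_, Eventually.of_forall ht0⟩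
    exact squeeze_zero ht0 ht1 tendsto_one_div_add_atTop_nhds_zero_nat
  have hb : ∀ x, ∃ C, ∀ n, ‖S (t n) x‖ ≤ C := by
    intro x
    have := ((hS.tendsto_zero' x).comp htend).norm
    obtain ⟨C, hC⟩ := this.bddAbove_range
    exact ⟨C, fun n => hC ⟨n, rfl⟩⟩
  obtain ⟨C, hC⟩ := banach_steinhaus hb
  obtain ⟨n, hn⟩ := exists_nat_gt C
  have := hC n
  have := ht2 n
  linarith

/-- Joint continuity of `(t, W) ↦ S t W` at `t = 0` from the right. -/
lemma tendsto_joint [CompleteSpace E] (hS : IsSemigroup S) (U : E) :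
    Tendsto (fun p : ℝ × E => S p.1 p.2) (𝓝[≥] (0 : ℝ) ×ˢ 𝓝 U) (𝓝 U) := by
  obtain ⟨M, hM, d, hd, hbd⟩ := hS.exists_bound
  have h1 : Tendsto (fun p : ℝ × E => S p.1 U) (𝓝[≥] (0 : ℝ) ×ˢ 𝓝 U) (𝓝 U) :=
    (hS.tendsto_zero' U).comp tendsto_fst
  have h2 : Tendsto (fun p : ℝ × E => S p.1 (p.2 - U)) (𝓝[≥] (0 : ℝ) ×ˢ 𝓝 U) (𝓝 0) := by
    have hev : ∀ᶠ p : ℝ × E in 𝓝[≥] (0 : ℝ) ×ˢ 𝓝 U, ‖S p.1 (p.2 - U)‖ ≤ M * ‖p.2 - U‖ := by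
      have : ∀ᶠ t in 𝓝[≥] (0 : ℝ), ‖S t‖ ≤ M := by
        filter_upwards [Icc_mem_nhdsGE hd] with t ht using hbd t ht.1 ht.2
      filter_upwards [tendsto_fst.eventually this] with p hp
      exact (S p.1).le_of_opNorm_le hp _
    refine squeeze_zero_norm' hev ?_
    have h3 : Tendsto (fun p : ℝ × E => p.2) (𝓝[≥] (0 : ℝ) ×ˢ 𝓝 U) (𝓝 U) := tendsto_snd
    simpa using ((h3.sub_const U).norm.const_mul M)
  simpa using h1.add h2

lemma exists_orbit_continuousOn [CompleteSpace E] (hS : IsSemigroup S) :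
    ∃ d > 0, ∀ U : E, ContinuousOn (fun t => S t U) (Icc 0 d) := by
  obtain ⟨M, hM, d, hd, hbd⟩ := hS.exists_bound
  refine ⟨d, hd, fun U => ?_⟩
  rw [Metric.continuousOn_iff]
  intro t ht ε hε
  have h0 := hS.tendsto_zero' U
  rw [Metric.tendsto_nhdsWithin_nhds] at h0
  obtain ⟨r, hr, h0⟩ := h0 (ε / M) (by positivity)
  -- both increments reduce to the increment at time `0`
  have key : ∀ s r', 0 ≤ s → s ≤ r' → r' ≤ d → r' - s < r → ‖S r' U - S s U‖ < ε := by
    intro s r' hs hsr hr' hlt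
    have e : S r' U - S s U = S s (S (r' - s) U - U) := by
      have := hS.add s (r' - s) hs (by linarith)
      rw [add_sub_cancel] at this
      rw [this, map_sub]; rfl
    rw [e]
    have h5 := h0 (show r' - s ∈ Ici (0 : ℝ) by simp; linarith)
      (by rw [Real.dist_eq, sub_zero, abs_of_nonneg (by linarith)]; exact hlt)
    rw [dist_eq_norm] at h5
    calc ‖S s (S (r' - s) U - U)‖ ≤ M * ‖S (r' - s) U - U‖ :=
          (S s).le_of_opNorm_le (hbd s hs (by linarith)) _
      _ < M * (ε / M) := by gcongr
      _ = ε := by field_simp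
  refine ⟨r, hr, fun s hs hst => ?_⟩
  rw [Real.dist_eq] at hst
  rw [dist_eq_norm]
  rcases le_total s t with h | h
  · rw [norm_sub_rev]
    exact key s t hs.1 h ht.2 (by rw [abs_sub_comm, abs_of_nonneg (by linarith)] at hst; exact hst)
  · exact key t s ht.1 h hs.2 (by rw [abs_of_nonneg (by linarith)] at hst; exact hst)

/-- The generator is densely defined: the averages `h⁻¹ ∫₀ʰ S(r) U dr` lie in its domain. -/
lemma exists_generatorGraph_near [CompleteSpace E] (hS : IsSemigroup S) (U : E) :
    ∃ᶠ W in 𝓝 U, ∃ V, GeneratorGraph S W V := by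
  obtain ⟨d, hd, hcont⟩ := hS.exists_orbit_continuousOn
  have hint : ∀ a b, 0 ≤ a → a ≤ d → 0 ≤ b → b ≤ d →
      IntervalIntegrable (fun r => S r U) volume a b := by
    intro a b ha had hb hbd
    exact ((hcont U).mono (uIcc_subset_Icc ⟨ha, had⟩ ⟨hb, hbd⟩)).intervalIntegrable
  have hright : ∀ a, 0 ≤ a → a < d →
      Tendsto (fun k : ℝ => k⁻¹ • ∫ r in a..(a + k), S r U) (𝓝[>] 0) (𝓝 (S a U)) := by
    intro a ha had
    have hc : ContinuousWithinAt (fun r => S r U) (Ici a) a :=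
      ((hcont U) a ⟨ha, had.le⟩).mono_of_mem_nhdsWithin
        (mem_of_superset (Icc_mem_nhdsGE had) (Icc_subset_Icc_left ha))
    have hd' : HasDerivWithinAt (fun x => ∫ r in a..x, S r U) (S a U) (Ici a) a := by
      refine intervalIntegral.integral_hasDerivWithinAt_right (t := Ioi a) (by simp) ?_
        (hc.mono Ioi_subset_Ici_self)
      refine ⟨Ioc a d, Ioc_mem_nhdsGT had, ?_⟩
      exact ((hcont U).mono (fun x hx => ⟨ha.trans hx.1.le, hx.2⟩)).aestronglyMeasurable
        measurableSet_Ioc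
    simpa using hasDerivWithinAt_Ici_iff_tendsto.1 hd'
  have hlim := hright 0 le_rfl hd
  simp only [zero_add, hS.zero, ContinuousLinearMap.id_apply] at hlim
  refine hlim.frequently (Eventually.frequently ?_)
  filter_upwards [Ioo_mem_nhdsGT hd] with h hh
  refine ⟨h⁻¹ • (S h U - U), ?_⟩
  have h2 := ((hright h hh.1.le hh.2).sub hlim).const_smul h⁻¹
  refine h2.congr' ?_
  filter_upwards [Ioo_mem_nhdsGT (sub_pos.2 hh.2)] with k hk
  have hk0 : 0 < k := hk.1
  have hk1 : k < d - h := hk.2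
  have hh0 : 0 < h := hh.1
  have hhd : h < d := hh.2
  have e1 : S k (∫ r in (0 : ℝ)..h, S r U) = ∫ r in k..(h + k), S r U := by
    rw [← ContinuousLinearMap.intervalIntegral_comp_comm _ (hint _ _ le_rfl hd.le hh0.le hhd.le)]
    have e2 : ∀ r ∈ uIcc 0 h, S k (S r U) = S (r + k) U := by
      intro r hr
      rw [uIcc_of_le hh0.le] at hr
      rw [add_comm, hS.add k r hk0.le hr.1]; rfl
    rw [intervalIntegral.integral_congr e2,
      intervalIntegral.integral_comp_add_right (fun r => S r U), zero_add]
  have e3 : (∫ r in k..(h + k), S r U) - ∫ r in (0 : ℝ)..h, S r U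
      = (∫ r in h..(h + k), S r U) - ∫ r in (0 : ℝ)..k, S r U := by
    have i1 := hint 0 k le_rfl hd.le hk0.le (by linarith)
    have i2 := hint k (h + k) hk0.le (by linarith) (by linarith) (by linarith)
    have i3 := hint 0 h le_rfl hd.le hh0.le hhd.le
    have i4 := hint h (h + k) hh0.le hhd.le (by linarith) (by linarith)
    have a1 := intervalIntegral.integral_add_adjacent_intervals i1 i2
    have a2 := intervalIntegral.integral_add_adjacent_intervals i3 i4
    rw [sub_eq_sub_iff_add_eq_add]
    exact ((add_comm _ _).trans a1).trans ((add_comm _ _).trans a2).symm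
  rw [map_smul, e1, ← smul_sub, ← smul_sub, e3, smul_comm]

/-- The domain of the generator is invariant under the semigroup, which commutes with the
generator. -/
lemma generatorGraph_apply (hS : IsSemigroup S) {U V : E} (h : GeneratorGraph S U V) {r : ℝ}
    (hr : 0 ≤ r) : GeneratorGraph S (S r U) (S r V) := by
  have h1 : Tendsto (fun t : ℝ => S r (t⁻¹ • (S t U - U))) (𝓝[>] (0 : ℝ)) (𝓝 (S r V)) :=
    ((S r).continuous.tendsto V).comp h
  refine h1.congr' ?_
  filter_upwards [self_mem_nhdsWithin] with t ht
  have e1 := hS.add r t hr (le_of_lt ht)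
  have e2 := hS.add t r (le_of_lt ht) hr
  rw [map_smul, map_sub]
  congr 2
  change ((S r).comp (S t)) U = ((S t).comp (S r)) U
  rw [← e1, ← e2, add_comm]

/-- Orbits in the domain of the generator are right differentiable. -/
lemma hasDerivWithinAt (hS : IsSemigroup S) {U V : E} (h : GeneratorGraph S U V) {r : ℝ}
    (hr : 0 ≤ r) : HasDerivWithinAt (fun t => S t U) (S r V) (Ici r) r := by
  have h1 := hS.generatorGraph_apply h hr
  rw [hasDerivWithinAt_Ici_iff_tendsto]
  refine h1.congr' ?_
  filter_upwards [self_mem_nhdsWithin] with k hk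
  rw [add_comm r k, hS.add k r (le_of_lt hk) hr]
  rfl

end IsSemigroup

/-! ### One-sided differential inequalities along mild solutions -/

namespace IsSemigroup

variable {E : Type*} [NormedAddCommGroup E] [NormedSpace ℝ E] [CompleteSpace E]
  {S : ℝ → E →L[ℝ] E}

/-- If `L V = K U` on the graph of the generator, then `L (S h U)` is right differentiable at
`h = 0` with derivative `K U` for every `U`, not only for those in the domain. -/
lemma tendsto_linear {F : Type*} [NormedAddCommGroup F] [NormedSpace ℝ F]
    (hS : IsSemigroup S) (L K : E →L[ℝ] F)
    (hLK : ∀ U V, GeneratorGraph S U V → L V = K U) (U : E) :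
    Tendsto (fun h : ℝ => h⁻¹ • (L (S h U) - L U)) (𝓝[>] (0 : ℝ)) (𝓝 (K U)) := by
  rw [Metric.tendsto_nhds]
  intro ε hε
  have hj := ((K.continuous.tendsto U).comp (hS.tendsto_joint U)).eventually
    (Metric.ball_mem_nhds _ (half_pos hε))
  obtain ⟨p, hp, p', hp', hpp⟩ := eventually_prod_iff.1 hj
  obtain ⟨d, hd, hcont⟩ := hS.exists_orbit_continuousOn
  obtain ⟨d', hd', hdp⟩ := mem_nhdsGE_iff_exists_Ico_subset.1 hp
  filter_upwards [Ioo_mem_nhdsGT (lt_min hd hd')] with h hh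
  have hh0 : 0 < h := hh.1
  have hhd : h < d := hh.2.trans_le (min_le_left _ _)
  have hhd' : h < d' := hh.2.trans_le (min_le_right _ _)
  have key : ∀ W, (∃ V, GeneratorGraph S W V) → p' W →
      ‖L (S h W) - L W - h • K U‖ ≤ ε / 2 * h := by
    rintro W ⟨V, hV⟩ hW
    have := norm_image_sub_le_of_norm_deriv_right_le_segment (a := 0) (b := h)
      (f := fun r => L (S r W) - r • K U) (f' := fun r => L (S r V) - (1 : ℝ) • K U) (C := ε / 2)
      ?_ ?_ ?_ h (right_mem_Icc.2 hh0.le)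
    · simpa [hS.zero, sub_right_comm] using this
    · exact (L.continuous.comp_continuousOn ((hcont W).mono (Icc_subset_Icc_right hhd.le))).sub
        (continuous_id.smul continuous_const).continuousOn
    · intro r hr
      exact (L.hasFDerivAt.comp_hasDerivWithinAt r (hS.hasDerivWithinAt hV hr.1)).sub
        ((hasDerivWithinAt_id r _).smul_const _)
    · intro r hr
      rw [hLK _ _ (hS.generatorGraph_apply hV hr.1), one_smul, ← dist_eq_norm]
      exact le_of_lt (hpp (hdp ⟨hr.1, hr.2.trans hhd'⟩) hW)
  have hfin : ‖L (S h U) - L U - h • K U‖ ≤ ε / 2 * h := by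
    have hfr : ∃ᶠ W in 𝓝 U, ‖L (S h W) - L W - h • K U‖ ≤ ε / 2 * h :=
      ((hS.exists_generatorGraph_near U).and_eventually hp').mono fun W hW => key W hW.1 hW.2
    have hcl : IsClosed {W | ‖L (S h W) - L W - h • K U‖ ≤ ε / 2 * h} :=
      isClosed_le (by fun_prop) continuous_const
    exact hcl.mem_of_frequently_of_tendsto hfr tendsto_id
  rw [dist_eq_norm]
  have e : h⁻¹ • (L (S h U) - L U) - K U = h⁻¹ • (L (S h U) - L U - h • K U) := by
    rw [smul_sub _ _ (h • _), smul_smul, inv_mul_cancel₀ hh0.ne', one_smul]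
  rw [e, norm_smul, norm_inv, Real.norm_of_nonneg hh0.le]
  calc h⁻¹ * ‖L (S h U) - L U - h • K U‖ ≤ h⁻¹ * (ε / 2 * h) := by gcongr
    _ = ε / 2 := by field_simp
    _ < ε := half_lt_self hε

/-- A bound for the derivative of the quadratic form `B U U` on the graph of the generator
bounds its increments along every orbit. -/
lemma eventually_quadratic_le (hS : IsSemigroup S) (B : E →L[ℝ] E →L[ℝ] ℝ) (q : E → ℝ)
    (hq : Continuous q) (hBq : ∀ U V, GeneratorGraph S U V → B U V + B V U ≤ q U) (U : E) {c : ℝ}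
    (hc : q U < c) : ∀ᶠ h in 𝓝[>] (0 : ℝ), B (S h U) (S h U) ≤ B U U + c * h := by
  have hj := ((hq.tendsto U).comp (hS.tendsto_joint U)).eventually (gt_mem_nhds hc)
  obtain ⟨p, hp, p', hp', hpp⟩ := eventually_prod_iff.1 hj
  obtain ⟨d, hd, hcont⟩ := hS.exists_orbit_continuousOn
  obtain ⟨d', hd', hdp⟩ := mem_nhdsGE_iff_exists_Ico_subset.1 hp
  filter_upwards [Ioo_mem_nhdsGT (lt_min hd hd')] with h hh
  have hh0 : 0 < h := hh.1
  have hhd : h < d := hh.2.trans_le (min_le_left _ _)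
  have hhd' : h < d' := hh.2.trans_le (min_le_right _ _)
  have key : ∀ W, (∃ V, GeneratorGraph S W V) → p' W →
      B (S h W) (S h W) ≤ B W W + c * h := by
    rintro W ⟨V, hV⟩ hW
    have hder : ∀ r ∈ Ico 0 h, HasDerivWithinAt (fun r => B (S r W) (S r W))
        (B (S r W) (S r V) + B (S r V) (S r W)) (Ici r) r := by
      intro r hr
      have h1 := hS.hasDerivWithinAt hV hr.1
      exact B.hasDerivWithinAt_of_bilinear h1 h1
    have hcW := (hcont W).mono (Icc_subset_Icc_right hhd.le)
    have := image_le_of_deriv_right_le_deriv_boundary (a := 0) (b := h)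
      (f := fun r => B (S r W) (S r W))
      (B := fun r => B W W + c * r) (B' := fun _ => c) ?_ hder ?_ ?_ ?_ ?_ (right_mem_Icc.2 hh0.le)
    · exact this
    · exact B.isBoundedBilinearMap.continuous.comp_continuousOn (hcW.prodMk hcW)
    · simp [hS.zero]
    · fun_prop
    · intro r hr
      simpa using ((hasDerivWithinAt_id r (Ici r)).const_mul c).const_add (B W W)
    · intro r hr
      refine (hBq _ _ (hS.generatorGraph_apply hV hr.1)).trans ?_
      exact le_of_lt (hpp (hdp ⟨hr.1, hr.2.trans hhd'⟩) hW)
  have hfr : ∃ᶠ W in 𝓝 U, B (S h W) (S h W) ≤ B W W + c * h :=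
    ((hS.exists_generatorGraph_near U).and_eventually hp').mono fun W hW => key W hW.1 hW.2
  have hcl : IsClosed {W | B (S h W) (S h W) ≤ B W W + c * h} :=
    isClosed_le (by fun_prop) (by fun_prop)
  exact hcl.mem_of_frequently_of_tendsto hfr tendsto_id

end IsSemigroup

/-- `U` satisfies on `[0,∞)` the variation of constants formula for the semigroup `S` with
inhomogeneity `G`, and `G` is continuous from the right. -/
structure IsMild {E : Type*} [NormedAddCommGroup E] [NormedSpace ℝ E]
    (S : ℝ → E →L[ℝ] E) (G U : ℝ → E) : Prop where
  semigroup : IsSemigroup S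
  integrable : ∀ t, 0 ≤ t → IntervalIntegrable (fun s => S (t - s) (G s)) volume 0 t
  duhamel : ∀ t, 0 ≤ t → U t = S t (U 0) + ∫ s in (0 : ℝ)..t, S (t - s) (G s)
  right_cont : ∀ t, 0 ≤ t → ContinuousWithinAt G (Ici t) t

namespace IsMild

variable {E : Type*} [NormedAddCommGroup E] [NormedSpace ℝ E] [CompleteSpace E]
  {S : ℝ → E →L[ℝ] E} {G U : ℝ → E}

lemma duhamel_add (hU : IsMild S G U) {t h : ℝ} (ht : 0 ≤ t) (hh : 0 ≤ h) :
    U (t + h) - S h (U t) = ∫ s in t..(t + h), S (t + h - s) (G s) := by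
  have hi := hU.integrable (t + h) (by linarith)
  have hi1 : IntervalIntegrable (fun s => S (t + h - s) (G s)) volume 0 t :=
    hi.mono_set (by rw [uIcc_of_le ht, uIcc_of_le (by linarith)]; exact
      Icc_subset_Icc_right (by linarith))
  have hi2 : IntervalIntegrable (fun s => S (t + h - s) (G s)) volume t (t + h) :=
    hi.mono_set (by
      rw [uIcc_of_le (by linarith : t ≤ t + h), uIcc_of_le (by linarith)]
      exact Icc_subset_Icc_left ht)
  have e : ∀ s ∈ uIcc 0 t, S (t + h - s) (G s) = S h (S (t - s) (G s)) := by
    intro s hs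
    rw [uIcc_of_le ht] at hs
    rw [show t + h - s = h + (t - s) by ring, hU.semigroup.add h (t - s) hh (by linarith [hs.2])]
    rfl
  rw [hU.duhamel (t + h) (by linarith), ← intervalIntegral.integral_add_adjacent_intervals hi1 hi2,
    intervalIntegral.integral_congr e,
    ContinuousLinearMap.intervalIntegral_comp_comm _ (hU.integrable t ht),
    add_comm t h, hU.semigroup.add h t hh ht, hU.duhamel t ht, map_add]
  simp only [ContinuousLinearMap.comp_apply]
  abel

/-- To first order, a mild solution differs from the orbit of the semigroup by `h • G t`. -/
lemma tendsto_increment (hU : IsMild S G U) {t : ℝ} (ht : 0 ≤ t) :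
    Tendsto (fun h : ℝ => h⁻¹ • (U (t + h) - S h (U t))) (𝓝[>] (0 : ℝ)) (𝓝 (G t)) := by
  rw [Metric.tendsto_nhds]
  intro ε hε
  have hj := (hU.semigroup.tendsto_joint (G t)).eventually
    (Metric.ball_mem_nhds _ (half_pos hε))
  obtain ⟨p, hp, p', hp', hpp⟩ := eventually_prod_iff.1 hj
  obtain ⟨d, hd, hdp⟩ := mem_nhdsGE_iff_exists_Ico_subset.1 hp
  obtain ⟨d', hd', hdp'⟩ := mem_nhdsGE_iff_exists_Ico_subset.1 ((hU.right_cont t ht).eventually hp')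
  have hd0 : 0 < d := hd
  have hd0' : t < d' := hd'
  filter_upwards [Ioo_mem_nhdsGT (lt_min hd0 (sub_pos.2 hd0'))] with h hh
  have hh0 : 0 < h := hh.1
  have hhd : h < d := hh.2.trans_le (min_le_left _ _)
  have hhd' : h < d' - t := hh.2.trans_le (min_le_right _ _)
  have hi2 : IntervalIntegrable (fun s => S (t + h - s) (G s)) volume t (t + h) :=
    (hU.integrable (t + h) (by linarith)).mono_set (by
      rw [uIcc_of_le (by linarith : t ≤ t + h), uIcc_of_le (by linarith)]
      exact Icc_subset_Icc_left ht)
  have e : U (t + h) - S h (U t) - h • G t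
      = ∫ s in t..(t + h), (S (t + h - s) (G s) - G t) := by
    rw [intervalIntegral.integral_sub hi2 (by simp), hU.duhamel_add ht hh0.le]
    simp
  have hn : ‖U (t + h) - S h (U t) - h • G t‖ ≤ ε / 2 * h := by
    rw [e]
    have := intervalIntegral.norm_integral_le_of_norm_le_const (a := t) (b := t + h) (C := ε / 2)
      (f := fun s => S (t + h - s) (G s) - G t) ?_
    · simpa [abs_of_pos hh0] using this
    · intro s hs
      rw [uIoc_of_le (by linarith)] at hs
      rw [← dist_eq_norm]
      have h1 : p (t + h - s) := hdp ⟨by linarith [hs.2], by linarith [hs.1]⟩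
      have h2 : p' (G s) := hdp' ⟨hs.1.le, by linarith [hs.2]⟩
      exact le_of_lt (hpp h1 h2)
  rw [dist_eq_norm]
  have e : h⁻¹ • (U (t + h) - S h (U t)) - G t = h⁻¹ • (U (t + h) - S h (U t) - h • G t) := by
    rw [smul_sub _ _ (h • _), smul_smul, inv_mul_cancel₀ hh0.ne', one_smul]
  rw [e, norm_smul, norm_inv, Real.norm_of_nonneg hh0.le]
  calc h⁻¹ * ‖U (t + h) - S h (U t) - h • G t‖ ≤ h⁻¹ * (ε / 2 * h) := by gcongr
    _ = ε / 2 := by field_simp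
    _ < ε := half_lt_self hε

lemma hasDerivWithinAt_linear {F : Type*} [NormedAddCommGroup F] [NormedSpace ℝ F]
    (hU : IsMild S G U) (L K : E →L[ℝ] F)
    (hLK : ∀ U V, GeneratorGraph S U V → L V = K U) {t : ℝ} (ht : 0 ≤ t) :
    HasDerivWithinAt (fun t => L (U t)) (K (U t) + L (G t)) (Ici t) t := by
  rw [hasDerivWithinAt_Ici_iff_tendsto]
  have h1 := hU.semigroup.tendsto_linear L K hLK (U t)
  have h2 := (L.continuous.tendsto _).comp (hU.tendsto_increment ht)
  refine (h1.add h2).congr fun h => ?_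
  simp only [Function.comp, map_smul, map_sub]
  rw [← smul_add]
  congr 1
  abel

/-- The upper right Dini derivative of a quadratic form along a mild solution is at most the bound
for its derivative on the graph of the generator plus the contribution of the inhomogeneity. -/
lemma eventually_quadratic_lt (hU : IsMild S G U) (B : E →L[ℝ] E →L[ℝ] ℝ) (q : E → ℝ)
    (hq : Continuous q) (hBq : ∀ U V, GeneratorGraph S U V → B U V + B V U ≤ q U) {t : ℝ}
    (ht : 0 ≤ t) {c : ℝ} (hc : q (U t) + B (U t) (G t) + B (G t) (U t) < c) :
    ∀ᶠ h in 𝓝[>] (0 : ℝ), B (U (t + h)) (U (t + h)) < B (U t) (U t) + c * h := by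
  obtain ⟨c₁, hc₁, hc₁'⟩ := exists_between
    (show q (U t) < c - (B (U t) (G t) + B (G t) (U t)) by linarith)
  have h1 := hU.semigroup.eventually_quadratic_le B q hq hBq (U t) hc₁
  have hD := hU.tendsto_increment ht
  have hSU := hU.semigroup.tendsto_zero (U t)
  have hid : Tendsto (fun h : ℝ => h) (𝓝[>] (0 : ℝ)) (𝓝 0) := nhdsWithin_le_nhds
  have hB := B.isBoundedBilinearMap.continuous
  have hlim : Tendsto (fun h : ℝ => B (S h (U t)) (h⁻¹ • (U (t + h) - S h (U t)))
      + B (h⁻¹ • (U (t + h) - S h (U t))) (S h (U t))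
      + h * B (h⁻¹ • (U (t + h) - S h (U t))) (h⁻¹ • (U (t + h) - S h (U t))))
      (𝓝[>] (0 : ℝ)) (𝓝 (B (U t) (G t) + B (G t) (U t) + 0 * B (G t) (G t))) :=
    (((hB.tendsto (U t, G t)).comp (hSU.prodMk_nhds hD)).add
      ((hB.tendsto (G t, U t)).comp (hD.prodMk_nhds hSU))).add
      (hid.mul ((hB.tendsto (G t, G t)).comp (hD.prodMk_nhds hD)))
  have h2 := hlim.eventually (gt_mem_nhds (show _ < c - c₁ by linarith))
  filter_upwards [h1, h2, self_mem_nhdsWithin] with h k1 k2 hh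
  have hh0 : 0 < h := hh
  set D := U (t + h) - S h (U t) with hDdef
  have e : U (t + h) = S h (U t) + h • (h⁻¹ • D) := by
    rw [smul_smul, mul_inv_cancel₀ hh0.ne', one_smul, hDdef]; abel
  rw [e]
  generalize h⁻¹ • D = D' at *
  simp only [map_add, map_smul, add_apply, smul_apply,
    smul_eq_mul]
  nlinarith [mul_lt_mul_of_pos_left k2 hh0]

end IsMild

/-! ### Functions of one variable with a square integrable derivative -/

instance isProbabilityMeasure_vol01 : IsProbabilityMeasure vol01 := ⟨by simp⟩

lemma inner_eq_integral (a c : L2) : ⟪a, c⟫_ℝ = ∫ x in Ioo (0 : ℝ) 1, a x * c x := by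
  rw [L2.inner_def]
  exact integral_congr_ae (Eventually.of_forall fun _ => Real.inner_apply _ _)

lemma integrable_mul (a c : L2) : Integrable (fun x => a x * c x) vol01 :=
  (L2.integrable_inner a c).congr (Eventually.of_forall fun _ => Real.inner_apply _ _)

lemma norm_sq_eq_integral (a : L2) : ‖a‖ ^ 2 = ∫ x in Ioo (0 : ℝ) 1, (a x) ^ 2 := by
  rw [← real_inner_self_eq_norm_sq, inner_eq_integral]
  simp only [sq]

lemma integrable_L2 (a : L2) : Integrable (a : ℝ → ℝ) vol01 :=
  (Lp.memLp a).integrable (by norm_num)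

lemma intervalIntegrable_L2 (a : L2) : IntervalIntegrable (a : ℝ → ℝ) volume 0 1 := by
  rw [intervalIntegrable_iff_integrableOn_Ioo_of_le zero_le_one]
  exact integrable_L2 a

lemma integral_Ioo_eq (f : ℝ → ℝ) : ∫ x in Ioo (0 : ℝ) 1, f x = ∫ x in (0 : ℝ)..1, f x := by
  rw [intervalIntegral.integral_of_le zero_le_one, integral_Ioc_eq_integral_Ioo]

/-- The Cauchy-Schwarz inequality against the constant function `1`. -/
lemma integral_abs_le_norm (a : L2) : ∫ x in Ioo (0 : ℝ) 1, |a x| ≤ ‖a‖ := by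
  have h1 := (integrable_L2 a).abs
  have h2 : Integrable (fun x => (a x) ^ 2) vol01 := (Lp.memLp a).integrable_sq
  set m := ∫ x in Ioo (0 : ℝ) 1, |a x| with hm
  have h3 : 0 ≤ ∫ x in Ioo (0 : ℝ) 1, (|a x| - m) ^ 2 := integral_nonneg fun x => sq_nonneg _
  have h4 : ∫ x in Ioo (0 : ℝ) 1, (|a x| - m) ^ 2 = ‖a‖ ^ 2 - m ^ 2 := by
    have e : ∀ x, (|a x| - m) ^ 2 = (a x) ^ 2 - 2 * m * |a x| + m ^ 2 := by
      intro x; rw [← sq_abs (a x)]; ring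
    simp_rw [e]
    have h5 : Integrable (fun x => (a x) ^ 2 - 2 * m * |a x|) vol01 := h2.sub (h1.const_mul _)
    rw [integral_add h5 (integrable_const _), integral_sub h2 (h1.const_mul _), integral_const_mul, ← hm,
      norm_sq_eq_integral]
    simp
    ring
  exact abs_le_of_sq_le_sq' (by linarith) (norm_nonneg a) |>.2

/-- The primitive of `a` vanishing at `0`; only its values on `[0,1]` are meaningful. -/
def prim (a : L2) (x : ℝ) : ℝ := ∫ t in (0 : ℝ)..x, a t

lemma abs_prim_le (a : L2) {x : ℝ} (hx : x ∈ Icc (0 : ℝ) 1) : |prim a x| ≤ ‖a‖ := by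
  have hi := (intervalIntegrable_L2 a).abs
  have hx' : IntervalIntegrable (fun t => |a t|) volume 0 x :=
    hi.mono_set (by rw [uIcc_of_le hx.1, uIcc_of_le zero_le_one]; exact Icc_subset_Icc_right hx.2)
  calc |prim a x| ≤ ∫ t in (0 : ℝ)..x, |a t| := intervalIntegral.abs_integral_le_integral_abs hx.1
    _ ≤ ∫ t in (0 : ℝ)..1, |a t| :=
        intervalIntegral.integral_mono_interval le_rfl hx.1 hx.2
          (Eventually.of_forall fun _ => abs_nonneg _) hi
    _ ≤ ‖a‖ := by rw [← integral_Ioo_eq]; exact integral_abs_le_norm a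

lemma absolutelyContinuous_prim (a : L2) : AbsolutelyContinuousOnInterval (prim a) 0 1 :=
  (intervalIntegrable_L2 a).absolutelyContinuousOnInterval_intervalIntegral (by simp)

lemma continuousOn_prim (a : L2) : ContinuousOn (prim a) (Icc 0 1) := by
  have := (absolutelyContinuous_prim a).continuousOn
  rwa [uIcc_of_le zero_le_one] at this

lemma ae_hasDerivAt_prim (a : L2) : ∀ᵐ x ∂vol01, HasDerivAt (prim a) (a x) x := by
  rw [ae_restrict_iff' measurableSet_Ioo]
  filter_upwards [(intervalIntegrable_L2 a).ae_hasDerivAt_integral] with x hx hx'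
  exact hx (by rw [uIcc_of_le zero_le_one]; exact Ioo_subset_Icc_self hx') 0 (by simp)

lemma prim_zero (a : L2) : prim a 0 = 0 := intervalIntegral.integral_same

lemma prim_congr {a : L2} {g : ℝ → ℝ} (h : (a : ℝ → ℝ) =ᵐ[vol01] g) {x : ℝ}
    (hx : x ∈ Icc (0 : ℝ) 1) : prim a x = ∫ t in (0 : ℝ)..x, g t := by
  refine intervalIntegral.integral_congr_ae_restrict ?_
  rw [uIoc_of_le hx.1, ← restrict_Ioo_eq_restrict_Ioc]
  exact ae_restrict_of_ae_restrict_of_subset (Ioo_subset_Ioo_right hx.2) h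

lemma intervalIntegrable_L2' (a : L2) {x : ℝ} (hx : x ∈ Icc (0 : ℝ) 1) :
    IntervalIntegrable (a : ℝ → ℝ) volume 0 x :=
  (intervalIntegrable_L2 a).mono_set
    (by rw [uIcc_of_le hx.1, uIcc_of_le zero_le_one]; exact Icc_subset_Icc_right hx.2)

lemma prim_add (a c : L2) {x : ℝ} (hx : x ∈ Icc (0 : ℝ) 1) :
    prim (a + c) x = prim a x + prim c x := by
  rw [prim_congr (Lp.coeFn_add a c) hx]
  exact intervalIntegral.integral_add (intervalIntegrable_L2' a hx) (intervalIntegrable_L2' c hx)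

lemma prim_smul (r : ℝ) (a : L2) {x : ℝ} (hx : x ∈ Icc (0 : ℝ) 1) :
    prim (r • a) x = r * prim a x := by
  rw [prim_congr (Lp.coeFn_smul r a) hx]
  exact intervalIntegral.integral_const_mul _ _

lemma ae_mem_Icc : ∀ᵐ x ∂vol01, x ∈ Icc (0 : ℝ) 1 :=
  (ae_restrict_mem measurableSet_Ioo).mono fun _ hx => Ioo_subset_Icc_self hx

/-- A function that is bounded by a constant almost everywhere has at most that norm in
`L²(0,1)`, as the interval has length one. -/
lemma norm_le_of_ae_abs_le {a : L2} {C : ℝ} (hC : 0 ≤ C) (h : ∀ᵐ x ∂vol01, |a x| ≤ C) :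
    ‖a‖ ≤ C := by
  have := Lp.norm_le_of_ae_bound (f := a) hC h
  simpa [measureUnivNNReal] using this

lemma memLp_prim (a : L2) : MemLp (prim a) 2 vol01 :=
  MemLp.of_bound
    (((continuousOn_prim a).mono Ioo_subset_Icc_self).aestronglyMeasurable measurableSet_Ioo)
    ‖a‖ (ae_mem_Icc.mono fun _ hx => abs_prim_le a hx)

/-- The Volterra operator `a ↦ ∫₀ˣ a` on `L²(0,1)`. -/
def volterra : L2 →L[ℝ] L2 :=
  LinearMap.mkContinuous
    { toFun := fun a => (memLp_prim a).toLp
      map_add' := fun a c => by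
        rw [← MemLp.toLp_add]
        exact MemLp.toLp_congr _ _ (ae_mem_Icc.mono fun _ hx => prim_add a c hx)
      map_smul' := fun r a => by
        rw [RingHom.id_apply, ← MemLp.toLp_const_smul]
        exact MemLp.toLp_congr _ _ (ae_mem_Icc.mono fun _ hx => prim_smul r a hx) }
    1 (fun a => by
      rw [one_mul]
      refine norm_le_of_ae_abs_le (norm_nonneg a) ?_
      filter_upwards [(memLp_prim a).coeFn_toLp, ae_mem_Icc] with x hx hx'
      exact (congrArg abs hx).trans_le (abs_prim_le a hx'))

lemma coeFn_volterra (a : L2) : (volterra a : ℝ → ℝ) =ᵐ[vol01] prim a :=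
  (memLp_prim a).coeFn_toLp

lemma memLp_id : MemLp (fun x : ℝ => x) ∞ vol01 :=
  MemLp.of_bound aestronglyMeasurable_id 1
    (ae_mem_Icc.mono fun x hx => abs_le.2 ⟨by linarith [hx.1], hx.2⟩)

/-- Multiplication by the coordinate function on `L²(0,1)`. -/
def mulX : L2 →L[ℝ] L2 :=
  (ContinuousLinearMap.mul ℝ ℝ).holderL vol01 ∞ 2 2 memLp_id.toLp

lemma coeFn_mulX (a : L2) : (mulX a : ℝ → ℝ) =ᵐ[vol01] fun x => x * a x := by
  unfold mulX
  rw [ContinuousLinearMap.holderL_apply_apply]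
  filter_upwards [(ContinuousLinearMap.mul ℝ ℝ).coeFn_holder (r := 2) memLp_id.toLp a,
    memLp_id.coeFn_toLp] with x h1 h2
  rw [h1, h2]; rfl

/-- The constant function `1` in `L²(0,1)`. -/
def one : L2 := MemLp.toLp (fun _ => (1 : ℝ)) (memLp_const 1)

lemma coeFn_one : (one : ℝ → ℝ) =ᵐ[vol01] fun _ => 1 := MemLp.coeFn_toLp _

lemma inner_one (a : L2) : ⟪one, a⟫_ℝ = prim a 1 := by
  rw [inner_eq_integral, prim, ← integral_Ioo_eq]
  refine integral_congr_ae ?_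
  filter_upwards [coeFn_one] with x hx
  rw [hx, one_mul]

/-- `a ∈ H¹(0,1)` has the derivative `a'` and the boundary values `a₀` at `0` and `a₁` at `1`,
expressed through the fundamental theorem of calculus. -/
def HasTrace (a a' : L2) (a₀ a₁ : ℝ) : Prop :=
  (a : ℝ → ℝ) =ᵐ[vol01] (fun x => a₀ + prim a' x) ∧ a₁ = a₀ + prim a' 1

lemma integral_parts {F G f g : ℝ → ℝ} (hF : AbsolutelyContinuousOnInterval F 0 1)
    (hG : AbsolutelyContinuousOnInterval G 0 1) (hf : ∀ᵐ x ∂vol01, HasDerivAt F (f x) x)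
    (hg : ∀ᵐ x ∂vol01, HasDerivAt G (g x) x) :
    ∫ x in Ioo (0 : ℝ) 1, (f x * G x + F x * g x) = F 1 * G 1 - F 0 * G 0 := by
  rw [← hF.integral_deriv_mul_eq_sub hG, ← integral_Ioo_eq]
  refine integral_congr_ae ?_
  filter_upwards [hf, hg] with x h1 h2
  rw [h1.deriv, h2.deriv]

lemma absolutelyContinuous_const_add_prim (r : ℝ) (a : L2) :
    AbsolutelyContinuousOnInterval (fun x => r + prim a x) 0 1 := by
  have h : AbsolutelyContinuousOnInterval (fun _ : ℝ => r) 0 1 :=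
    (contDiff_const (n := 1)).contDiffOn.absolutelyContinuousOnInterval
  exact h.add (absolutelyContinuous_prim a)

lemma HasTrace.parts {a a' c c' : L2} {a₀ a₁ c₀ c₁ : ℝ} (ha : HasTrace a a' a₀ a₁)
    (hc : HasTrace c c' c₀ c₁) : ⟪a', c⟫_ℝ + ⟪a, c'⟫_ℝ = a₁ * c₁ - a₀ * c₀ := by
  have h := integral_parts (absolutelyContinuous_const_add_prim a₀ a')
    (absolutelyContinuous_const_add_prim c₀ c')
    ((ae_hasDerivAt_prim a').mono fun x hx => hx.const_add _)
    ((ae_hasDerivAt_prim c').mono fun x hx => hx.const_add _)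
  rw [← ha.2, ← hc.2, prim_zero, prim_zero, add_zero, add_zero] at h
  rw [← h, inner_eq_integral, inner_eq_integral,
    ← integral_add (integrable_mul _ _) (integrable_mul _ _)]
  refine integral_congr_ae ?_
  filter_upwards [ha.1, hc.1] with x h1 h2
  rw [h1, h2]

/-- Integration by parts with the weight `x`. -/
lemma HasTrace.parts_mulX {a a' c c' : L2} {a₀ a₁ c₀ c₁ : ℝ} (ha : HasTrace a a' a₀ a₁)
    (hc : HasTrace c c' c₀ c₁) :
    ⟪a', mulX c⟫_ℝ + ⟪a, mulX c'⟫_ℝ + ⟪a, c⟫_ℝ = a₁ * c₁ := by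
  have hX : AbsolutelyContinuousOnInterval (fun x : ℝ => x) 0 1 :=
    (contDiff_id (n := 1)).contDiffOn.absolutelyContinuousOnInterval
  have h := integral_parts (absolutelyContinuous_const_add_prim a₀ a')
    (hX.mul (absolutelyContinuous_const_add_prim c₀ c'))
    ((ae_hasDerivAt_prim a').mono fun x hx => hx.const_add _)
    ((ae_hasDerivAt_prim c').mono fun x hx => (hasDerivAt_id x).mul (hx.const_add _))
  simp only [Pi.mul_apply] at h
  rw [← ha.2, ← hc.2] at h
  simp only [one_mul, zero_mul, mul_zero, sub_zero] at h
  have hi : Integrable (fun x => a' x * mulX c x + a x * mulX c' x) vol01 :=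
    (integrable_mul _ _).add (integrable_mul _ _)
  rw [← h, inner_eq_integral, inner_eq_integral, inner_eq_integral,
    ← integral_add (integrable_mul _ _) (integrable_mul _ _),
    ← integral_add hi (integrable_mul _ _)]
  refine integral_congr_ae ?_
  filter_upwards [ha.1, hc.1, coeFn_mulX c, coeFn_mulX c'] with x h1 h2 h3 h4
  rw [h1, h3, h4, h2]
  simp only [id]
  ring

lemma inner_mulX_comm (a c : L2) : ⟪mulX a, c⟫_ℝ = ⟪a, mulX c⟫_ℝ := by
  rw [inner_eq_integral, inner_eq_integral]
  refine integral_congr_ae ?_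
  filter_upwards [coeFn_mulX a, coeFn_mulX c] with x h1 h2
  rw [h1, h2]; ring

/-- Weighted norms for `1 - 2x`: multiplication by this weight does not increase the norm. -/
lemma norm_sub_two_mulX_le (a : L2) : ‖a - (2 : ℝ) • mulX a‖ ≤ ‖a‖ := by
  refine Lp.norm_le_norm_of_ae_le ?_
  filter_upwards [Lp.coeFn_sub a ((2 : ℝ) • mulX a), Lp.coeFn_smul (2 : ℝ) (mulX a), coeFn_mulX a,
    ae_mem_Icc] with x h1 h2 h3 h4
  rw [h1, Pi.sub_apply, h2, Pi.smul_apply, h3, smul_eq_mul,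
    show a x - 2 * (x * a x) = (1 - 2 * x) * a x by ring, norm_mul]
  have : ‖1 - 2 * x‖ ≤ 1 := abs_le.2 ⟨by linarith [h4.2], by linarith [h4.1]⟩
  exact mul_le_of_le_one_left (norm_nonneg _) this

lemma hasTrace_volterra (a : L2) : HasTrace (volterra a) a 0 (prim a 1) :=
  ⟨by simpa using coeFn_volterra a, by simp⟩

lemma HasTrace.eq_volterra {a a' : L2} {a₁ : ℝ} (h : HasTrace a a' 0 a₁) : a = volterra a' := by
  refine Lp.ext (h.1.trans ?_)
  simpa using (coeFn_volterra a').symm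

lemma HasTrace.ae_abs_le {a a' : L2} {a₁ : ℝ} (h : HasTrace a a' 0 a₁) :
    ∀ᵐ x ∂vol01, |a x| ≤ ‖a'‖ := by
  filter_upwards [h.1, ae_mem_Icc] with x h1 h2
  rw [h1, zero_add]
  exact abs_prim_le a' h2

lemma HasTrace.norm_le {a a' : L2} {a₁ : ℝ} (h : HasTrace a a' 0 a₁) : ‖a‖ ≤ ‖a'‖ :=
  norm_le_of_ae_abs_le (norm_nonneg _) h.ae_abs_le

/-! ### Weak derivatives and the space of functions vanishing at the boundary -/

lemma IsTest.memLp {χ : ℝ → ℝ} (h : IsTest χ) : MemLp χ 2 vol01 :=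
  (h.1.continuous.memLp_of_hasCompactSupport h.2.1).restrict _

lemma IsTest.memLp_deriv {χ : ℝ → ℝ} (h : IsTest χ) : MemLp (deriv χ) 2 vol01 :=
  ((h.1.continuous_deriv (by simp)).memLp_of_hasCompactSupport h.2.1.deriv).restrict _

lemma IsTest.eq_zero {χ : ℝ → ℝ} (h : IsTest χ) {x : ℝ} (hx : x ∉ Ioo (0 : ℝ) 1) : χ x = 0 :=
  image_eq_zero_of_notMem_tsupport fun hx' => hx (h.2.2 hx')

lemma IsTest.hasTrace {χ : ℝ → ℝ} (h : IsTest χ) {a a' : L2} (ha : (a : ℝ → ℝ) =ᵐ[vol01] χ)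
    (ha' : (a' : ℝ → ℝ) =ᵐ[vol01] deriv χ) : HasTrace a a' 0 0 := by
  have key : ∀ x ∈ Icc (0 : ℝ) 1, prim a' x = χ x := by
    intro x hx
    rw [prim_congr ha' hx, intervalIntegral.integral_deriv_eq_sub'  _ rfl
      (fun y _ => (h.1.differentiable (by simp)) y) (h.1.continuous_deriv (by simp)).continuousOn,
      h.eq_zero (x := 0) (by simp), sub_zero]
  refine ⟨?_, ?_⟩
  · filter_upwards [ha, ae_mem_Icc] with x h1 h2
    rw [h1, key x h2, zero_add]
  · rw [key 1 (by simp), h.eq_zero (x := 1) (by simp), zero_add]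

lemma hasTrace_of_mem_H10 {p : L2 × L2} (hp : p ∈ H10) : HasTrace p.1 p.2 0 0 := by
  let T : L2 × L2 →L[ℝ] L2 × ℝ :=
    (ContinuousLinearMap.fst ℝ L2 L2 - volterra.comp (ContinuousLinearMap.snd ℝ L2 L2)).prod
      ((innerSL ℝ one).comp (ContinuousLinearMap.snd ℝ L2 L2))
  have hker : ∀ q : L2 × L2, HasTrace q.1 q.2 0 0 ↔ T q = 0 := by
    intro q
    have hT : T q = 0 ↔ q.1 = volterra q.2 ∧ prim q.2 1 = 0 := by
      simp only [T, Prod.ext_iff, ContinuousLinearMap.prod_apply, sub_apply,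
        ContinuousLinearMap.comp_apply, ContinuousLinearMap.coe_fst', ContinuousLinearMap.coe_snd',
        innerSL_apply_apply, inner_one, Prod.fst_zero, Prod.snd_zero, sub_eq_zero]
    rw [hT]
    constructor
    · intro h
      exact ⟨h.eq_volterra, by simpa using h.2.symm⟩
    · rintro ⟨h1, h2⟩
      have := hasTrace_volterra q.2
      rwa [← h1, h2] at this
  have hle : H10 ≤ LinearMap.ker (T : L2 × L2 →ₗ[ℝ] L2 × ℝ) := by
    refine Submodule.topologicalClosure_minimal _ ?_ T.isClosed_ker
    rw [Submodule.span_le]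
    rintro q ⟨χ, hχ, h1, h2⟩
    exact (hker q).1 (hχ.hasTrace h1 h2)
  exact (hker p).2 (hle hp)

/-- A smooth bump supported in `(0,1)` with integral one. -/
lemma exists_isTest_integral_eq_one : ∃ χ : ℝ → ℝ, IsTest χ ∧ ∫ x in Ioo (0 : ℝ) 1, χ x = 1 := by
  let β : ContDiffBump (1 / 2 : ℝ) := ⟨1 / 8, 1 / 4, by norm_num, by norm_num⟩
  have hsub : tsupport (β.normed volume) ⊆ Ioo (0 : ℝ) 1 := by
    rw [β.tsupport_normed_eq]
    intro x hx
    rw [Metric.mem_closedBall, Real.dist_eq, abs_le] at hx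
    have h1 : β.rOut = 1 / 4 := rfl
    rw [h1] at hx
    constructor <;> linarith [hx.1, hx.2]
  refine ⟨β.normed volume, ⟨β.contDiff_normed, β.hasCompactSupport_normed, hsub⟩, ?_⟩
  rw [setIntegral_eq_integral_of_forall_compl_eq_zero, β.integral_normed]
  intro x hx
  exact image_eq_zero_of_notMem_tsupport fun hx' => hx (hsub hx')

/-- A test function with mean zero has a test function as its primitive. -/
lemma IsTest.exists_primitive {η : ℝ → ℝ} (h : IsTest η)
    (h0 : ∫ x in Ioo (0 : ℝ) 1, η x = 0) : ∃ χ : ℝ → ℝ, IsTest χ ∧ deriv χ = η := by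
  have hc := h.1.continuous
  have hd : ∀ x, HasDerivAt (fun x => ∫ t in (0 : ℝ)..x, η t) (η x) x := fun x =>
    intervalIntegral.integral_hasDerivAt_right (hc.intervalIntegrable _ _)
      hc.stronglyMeasurable.stronglyMeasurableAtFilter hc.continuousAt
  have hde : deriv (fun x => ∫ t in (0 : ℝ)..x, η t) = η := funext fun x => (hd x).deriv
  obtain ⟨p, q, hp, hq, hpq⟩ : ∃ p q : ℝ, 0 < p ∧ q < 1 ∧ tsupport η ⊆ Icc p q := by
    rcases (tsupport η).eq_empty_or_nonempty with he | hne
    · exact ⟨1, 0, one_pos, zero_lt_one, by rw [he]; exact empty_subset _⟩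
    · have hK : IsCompact (tsupport η) := h.2.1
      exact ⟨_, _, (h.2.2 (hK.sInf_mem hne)).1, (h.2.2 (hK.sSup_mem hne)).2,
        fun x hx => ⟨csInf_le hK.bddBelow hx, le_csSup hK.bddAbove hx⟩⟩
  have hz : ∀ t, t ∉ Icc p q → η t = 0 := fun t ht =>
    image_eq_zero_of_notMem_tsupport fun h' => ht (hpq h')
  have hsupp : ∀ x, x ∉ Icc p q → ∫ t in (0 : ℝ)..x, η t = 0 := by
    intro x hx
    rcases lt_or_ge x p with hxp | hxp
    · refine intervalIntegral.integral_zero_ae (Eventually.of_forall fun t ht => hz t ?_)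
      intro ht'
      rcases le_total 0 x with h3 | h3
      · rw [uIoc_of_le h3] at ht; linarith [ht.2, ht'.1]
      · rw [uIoc_of_ge h3] at ht; linarith [ht.2, ht'.1]
    · have hxq : q < x := by
        by_contra! h4
        exact hx ⟨hxp, h4⟩
      rw [← intervalIntegral.integral_add_adjacent_intervals (b := 1)
        (hc.intervalIntegrable _ _) (hc.intervalIntegrable _ _), ← integral_Ioo_eq, h0, zero_add]
      refine intervalIntegral.integral_zero_ae (Eventually.of_forall fun t ht => hz t ?_)
      intro ht'
      rcases le_total 1 x with h3 | h3
      · rw [uIoc_of_le h3] at ht; linarith [ht.1, ht'.2]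
      · rw [uIoc_of_ge h3] at ht; linarith [ht.1, ht'.2]
  have htsupp : tsupport (fun x => ∫ t in (0 : ℝ)..x, η t) ⊆ Icc p q :=
    closure_minimal (fun x hx => by_contra fun h' => hx (hsupp x h')) isClosed_Icc
  refine ⟨_, ⟨?_, ?_, ?_⟩, hde⟩
  · rw [contDiff_infty_iff_deriv, hde]
    exact ⟨fun x => (hd x).differentiableAt, h.1⟩
  · exact isCompact_Icc.of_isClosed_subset (isClosed_tsupport _) htsupp
  · exact htsupp.trans fun x hx => ⟨hp.trans_le hx.1, hx.2.trans_lt hq⟩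

lemma inner_toLp {a : L2} {χ : ℝ → ℝ} (hχ : MemLp χ 2 vol01) :
    ⟪a, hχ.toLp⟫_ℝ = ∫ x in Ioo (0 : ℝ) 1, a x * χ x := by
  rw [inner_eq_integral]
  refine integral_congr_ae ?_
  filter_upwards [hχ.coeFn_toLp] with x hx
  rw [hx]

/-- The lemma of du Bois-Reymond: a weakly differentiable function is, up to a constant, the
primitive of its weak derivative. -/
lemma IsWeakDeriv.exists_hasTrace {a w : L2} (h : IsWeakDeriv a w) :
    ∃ a₀ a₁ : ℝ, HasTrace a w a₀ a₁ := by
  obtain ⟨η₀, hη₀, hη₀1⟩ := exists_isTest_integral_eq_one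
  set g : L2 := a - volterra w with hg
  have horth : ∀ χ, ∀ hχ : IsTest χ, ⟪g, hχ.memLp_deriv.toLp⟫_ℝ = 0 := by
    intro χ hχ
    have h1 := (hasTrace_volterra w).parts
      (hχ.hasTrace hχ.memLp.coeFn_toLp hχ.memLp_deriv.coeFn_toLp)
    have h2 := h χ hχ
    rw [← inner_toLp hχ.memLp_deriv, ← inner_toLp hχ.memLp] at h2
    rw [hg, inner_sub_left, h2]
    simp only [mul_zero, sub_zero] at h1
    linarith
  set c : ℝ := ⟪g, hη₀.memLp.toLp⟫_ℝ with hcdef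
  have hconst : ∀ χ : ℝ → ℝ, ContDiff ℝ ∞ χ → HasCompactSupport χ → tsupport χ ⊆ Ioo (0 : ℝ) 1 →
      ∫ x, χ x • (g x - c) = 0 := by
    intro χ h1 h2 h3
    have hχ : IsTest χ := ⟨h1, h2, h3⟩
    set m : ℝ := ∫ x in Ioo (0 : ℝ) 1, χ x with hm
    have hi1 : Integrable χ vol01 := hχ.memLp.integrable (by norm_num)
    have hi2 : Integrable η₀ vol01 := hη₀.memLp.integrable (by norm_num)
    have hη : IsTest (fun x => χ x - m * η₀ x) := by
      refine ⟨h1.sub (contDiff_const.mul hη₀.1), h2.sub hη₀.2.1.mul_left, ?_⟩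
      exact (tsupport_sub _ _).trans
        (union_subset h3 ((tsupport_mul_subset_right (f := fun _ => m)).trans hη₀.2.2))
    have hη0 : ∫ x in Ioo (0 : ℝ) 1, (χ x - m * η₀ x) = 0 := by
      rw [integral_sub hi1 (hi2.const_mul _), integral_const_mul, hη₀1, ← hm]; ring
    obtain ⟨ψ, hψ, hψd⟩ := hη.exists_primitive hη0
    have h4 := horth ψ hψ
    rw [inner_toLp, hψd] at h4
    have i1 : Integrable (fun x => g x * χ x) vol01 :=
      (integrable_mul g hχ.memLp.toLp).congr (hχ.memLp.coeFn_toLp.mono fun x hx => by simp only [hx])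
    have i2 : Integrable (fun x => g x * η₀ x) vol01 :=
      (integrable_mul g hη₀.memLp.toLp).congr
        (hη₀.memLp.coeFn_toLp.mono fun x hx => by simp only [hx])
    have h5 : ∫ x in Ioo (0 : ℝ) 1, g x * (χ x - m * η₀ x)
        = (∫ x in Ioo (0 : ℝ) 1, g x * χ x) - m * c := by
      have e : ∀ x, g x * (χ x - m * η₀ x) = g x * χ x - m * (g x * η₀ x) := fun x => by ring
      simp_rw [e]
      rw [integral_sub i1 (i2.const_mul _), integral_const_mul, hcdef, inner_toLp]
    rw [← setIntegral_eq_integral_of_forall_compl_eq_zero (s := Ioo (0 : ℝ) 1)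
      (fun x hx => by simp [hχ.eq_zero hx])]
    have e : ∀ x, χ x • (g x - c) = g x * χ x - c * χ x := fun x => by simp; ring
    simp_rw [e]
    rw [integral_sub i1 (hi1.const_mul _), integral_const_mul, ← hm]
    linarith
  have hae := isOpen_Ioo.ae_eq_zero_of_integral_contDiff_smul_eq_zero
    (IntegrableOn.locallyIntegrableOn ((integrable_L2 g).sub (integrable_const c))) hconst
  have hae' : ∀ᵐ x ∂vol01, g x - c = 0 := (ae_restrict_iff' measurableSet_Ioo).2 hae
  refine ⟨c, c + prim w 1, ?_, rfl⟩
  filter_upwards [hae', Lp.coeFn_sub a (volterra w), coeFn_volterra w] with x h1 h2 h3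
  rw [hg, h2, Pi.sub_apply, h3] at h1
  linarith

/-- The boundary values are determined by any continuous representative. -/
lemma IsWeakDeriv.hasTrace {a w : L2} (h : IsWeakDeriv a w) {p q : ℝ}
    (hb : HasBoundaryValues a p q) : HasTrace a w p q := by
  obtain ⟨a₀, a₁, h1, h2⟩ := h.exists_hasTrace
  obtain ⟨g, hg, hag, rfl, rfl⟩ := hb
  have hc : ContinuousOn (fun x => a₀ + prim w x) (Icc 0 1) :=
    continuousOn_const.add (continuousOn_prim w)
  have hae : (fun x => a₀ + prim w x) =ᵐ[vol01] g := h1.symm.trans hag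
  have heq : EqOn (fun x => a₀ + prim w x) g (Icc 0 1) :=
    Measure.eqOn_Icc_of_ae_eq volume zero_ne_one
      (by rw [← restrict_Ioo_eq_restrict_Icc]; exact hae) hc hg
  have e0 := heq (left_mem_Icc.2 zero_le_one)
  have e1 := heq (right_mem_Icc.2 zero_le_one)
  simp only [prim_zero, add_zero] at e0
  refine ⟨?_, ?_⟩
  · rwa [← e0]
  · rw [← e1, ← e0]

/-! ### Quadratic functionals and their derivatives along the linear system -/

/-- The component `u` of a state, as a continuous linear map. -/
def uL : State →L[ℝ] L2 :=
  (ContinuousLinearMap.fst ℝ L2 L2).comp (H10.subtypeL.comp (ContinuousLinearMap.fst ℝ _ _))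

/-- The component `uₓ` of a state, as a continuous linear map. -/
def uxL : State →L[ℝ] L2 :=
  (ContinuousLinearMap.snd ℝ L2 L2).comp (H10.subtypeL.comp (ContinuousLinearMap.fst ℝ _ _))

/-- The component `v` of a state, as a continuous linear map. -/
def vL : State →L[ℝ] L2 :=
  (ContinuousLinearMap.fst ℝ _ _).comp (ContinuousLinearMap.snd ℝ _ _)

/-- The components `(φ, ψ, z)` of a state, as a continuous linear map. -/
def tailL : State →L[ℝ] H10 × L2 × L2L2 :=
  (ContinuousLinearMap.snd ℝ _ _).comp (ContinuousLinearMap.snd ℝ _ _)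

/-- The component `φ` of a state, as a continuous linear map. -/
def φL : State →L[ℝ] L2 :=
  ((ContinuousLinearMap.fst ℝ L2 L2).comp
    (H10.subtypeL.comp (ContinuousLinearMap.fst ℝ _ _))).comp tailL

/-- The component `φₓ` of a state, as a continuous linear map. -/
def φxL : State →L[ℝ] L2 :=
  ((ContinuousLinearMap.snd ℝ L2 L2).comp
    (H10.subtypeL.comp (ContinuousLinearMap.fst ℝ _ _))).comp tailL

/-- The component `ψ` of a state, as a continuous linear map. -/
def ψL : State →L[ℝ] L2 :=
  ((ContinuousLinearMap.fst ℝ _ _).comp (ContinuousLinearMap.snd ℝ _ _)).comp tailL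

/-- The component `z` of a state, as a continuous linear map. -/
def zL : State →L[ℝ] L2L2 :=
  ((ContinuousLinearMap.snd ℝ _ _).comp (ContinuousLinearMap.snd ℝ _ _)).comp tailL

lemma uL_apply (U : State) : uL U = U.u := rfl
lemma uxL_apply (U : State) : uxL U = U.ux := rfl
lemma vL_apply (U : State) : vL U = U.v := rfl
lemma φL_apply (U : State) : φL U = U.φ := rfl
lemma φxL_apply (U : State) : φxL U = U.φx := rfl
lemma ψL_apply (U : State) : ψL U = U.ψ := rfl
lemma zL_apply (U : State) : zL U = U.z := rfl

/-- Bounded bilinear forms on a normed space. -/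
abbrev BilForm (E : Type*) [NormedAddCommGroup E] [NormedSpace ℝ E] : Type _ := E →L[ℝ] E →L[ℝ] ℝ

/-- The bounded bilinear form `(U, V) ↦ ⟪T U, T' V⟫` on the energy space. -/
def form {F : Type*} [NormedAddCommGroup F] [InnerProductSpace ℝ F] (T T' : State →L[ℝ] F) :
    BilForm State :=
  (innerSL ℝ).bilinearComp T T'

lemma form_apply {F : Type*} [NormedAddCommGroup F] [InnerProductSpace ℝ F]
    (T T' : State →L[ℝ] F) (U V : State) : form T T' U V = ⟪T U, T' V⟫_ℝ := rfl

/-- Multiplication by the weight `1 - 2x`, which is `1` at `x = 0` and `-1` at `x = 1`. -/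
def weightL : L2 →L[ℝ] L2 := ContinuousLinearMap.id ℝ L2 - (2 : ℝ) • mulX

lemma weightL_apply (a : L2) : weightL a = a - (2 : ℝ) • mulX a := rfl

lemma norm_weightL_le (a : L2) : ‖weightL a‖ ≤ ‖a‖ := norm_sub_two_mulX_le a

lemma inner_weightL_comm (a c : L2) : ⟪a, weightL c⟫_ℝ = ⟪c, weightL a⟫_ℝ := by
  rw [weightL_apply, weightL_apply, inner_sub_right, inner_sub_right, inner_smul_right,
    inner_smul_right, real_inner_comm a c, ← inner_mulX_comm c a, real_inner_comm a (mulX c)]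

/-- The weight `1 - 2x` makes both boundary terms appear with the same sign. -/
lemma HasTrace.inner_weightL {a a' : L2} {a₀ a₁ : ℝ} (h : HasTrace a a' a₀ a₁) :
    ⟪a', weightL a⟫_ℝ = ‖a‖ ^ 2 - (a₁ ^ 2 + a₀ ^ 2) / 2 := by
  have h1 := h.parts h
  have h2 := h.parts_mulX h
  rw [real_inner_comm a' a] at h1
  rw [← inner_mulX_comm a a', real_inner_comm a' (mulX a), real_inner_self_eq_norm_sq] at h2
  rw [weightL_apply, inner_sub_right, inner_smul_right]
  linear_combination h1 / 2 - h2

/-- `a ↦ ∫₀ˣ (a - ∫₀¹ a)`, the primitive of the mean-free part of `a`. -/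
def meanFreePrim : L2 →L[ℝ] L2 :=
  volterra.comp (ContinuousLinearMap.id ℝ L2 - (innerSL ℝ one).smulRight one)

lemma hasTrace_meanFreePrim (a : L2) :
    HasTrace (meanFreePrim a) (a - ⟪one, a⟫_ℝ • one) 0 0 := by
  have h := hasTrace_volterra (a - ⟪one, a⟫_ℝ • one)
  have h1 : prim one 1 = 1 := by
    rw [prim_congr coeFn_one (by simp)]; simp
  have h2 : prim (a - ⟪one, a⟫_ℝ • one) 1 = 0 := by
    rw [← inner_one, inner_sub_right, inner_smul_right, inner_one one, h1]; ring
  rw [h2] at h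
  exact h

/-- Multiplication by the delay coordinate `y` on `L²(0,1;L²(0,1))`. -/
def mulY : L2L2 →L[ℝ] L2L2 := mulX.compLpL 2 vol01

lemma L2L2_inner_eq (z w : L2L2) : ⟪z, w⟫_ℝ = ∫ x in Ioo (0 : ℝ) 1, ⟪z x, w x⟫_ℝ :=
  L2.inner_def z w

/-- The data witnessing `V = A U`, with the boundary conditions expressed by traces; `p₀, p₁` and
`r₀, r₁` are the boundary values of `uₓ` and `φₓ`. -/
structure GraphData (P : Coeffs) (U V : State) (uxx φxx z1 : L2) (zy : L2L2)
    (p₀ p₁ r₀ r₁ : ℝ) : Prop where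
  u : HasTrace U.u U.ux 0 0
  φ : HasTrace U.φ U.φx 0 0
  v : HasTrace U.v V.ux 0 0
  ψ : HasTrace U.ψ V.φx 0 0
  ux : HasTrace U.ux uxx p₀ p₁
  φx : HasTrace U.φx φxx r₀ r₁
  z : ∀ᵐ x ∂vol01, HasTrace (U.z x) (zy x) (U.ψ x) (z1 x)
  eq_u : V.u = U.v
  eq_v : V.v = (P.μ / P.ρ) • uxx + (P.b / P.ρ) • U.φx
  eq_φ : V.φ = U.ψ
  eq_ψ : V.ψ = (P.δ / P.J) • φxx - (P.b / P.J) • U.ux - (P.ξ / P.J) • U.φ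
      - (P.μ₁ / P.J) • U.ψ - (P.μ₂ / P.J) • z1
  eq_z : V.z = -((1 / P.τ) • zy)

lemma State.hasTrace_u (U : State) : HasTrace U.u U.ux 0 0 := hasTrace_of_mem_H10 U.1.2

lemma State.hasTrace_φ (U : State) : HasTrace U.φ U.φx 0 0 := hasTrace_of_mem_H10 U.2.2.1.2

lemma OperatorGraph.exists_graphData {P : Coeffs} {U V : State} (h : OperatorGraph P U V) :
    ∃ uxx φxx z1 zy p₀ p₁ r₀ r₁, GraphData P U V uxx φxx z1 zy p₀ p₁ r₀ r₁ := by
  obtain ⟨uxx, φxx, z1, zy, h1, h2, h3, h4, h5, h6, h7, h8, h9⟩ := h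
  obtain ⟨p₀, p₁, hp⟩ := h1.exists_hasTrace
  obtain ⟨r₀, r₁, hr⟩ := h2.exists_hasTrace
  refine ⟨uxx, φxx, z1, zy, p₀, p₁, r₀, r₁, U.hasTrace_u, U.hasTrace_φ, ?_, ?_, hp, hr, ?_,
    h5, h6, h7, h8, h9⟩
  · rw [← h5]; exact V.hasTrace_u
  · rw [← h7]; exact V.hasTrace_φ
  · filter_upwards [h3, h4] with x k1 k2 using k1.hasTrace k2

/-- The energy of the linear system, with the weight `τ μ₁` for the delay variable. -/
def energyForm (P : Coeffs) : BilForm State :=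
  (P.ρ / 2) • form vL vL + (P.J / 2) • form ψL ψL + (P.δ / 2) • form φxL φxL
    + (P.μ / 2) • form uxL uxL + P.b • form uxL φL + (P.ξ / 2) • form φL φL
    + (P.τ * P.μ₁ / 2) • form zL zL

/-- The functional `J ∫ ψ φ - (ρ b / μ) ∫ v w`, where `wₓ` is the mean-free part of `φ`; it
controls `φₓ`. -/
def phiForm (P : Coeffs) : BilForm State :=
  P.J • form ψL φL - (P.ρ * P.b / P.μ) • form vL (meanFreePrim.comp φL)

/-- The functional `b J ∫ (ψ uₓ + φₓ v)`; for equal wave speeds it controls `uₓ`. -/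
def crossForm (P : Coeffs) : BilForm State :=
  (P.b * P.J) • (form ψL uxL + form φxL vL)

/-- The functional `ρ ∫ (1 - 2x) v uₓ`, controlling the boundary values of `uₓ`. -/
def uBoundaryForm (P : Coeffs) : BilForm State :=
  P.ρ • form vL (weightL.comp uxL)

/-- The functional `J ∫ (1 - 2x) ψ φₓ`, controlling the boundary values of `φₓ`. -/
def phiBoundaryForm (P : Coeffs) : BilForm State :=
  P.J • form ψL (weightL.comp φxL)

/-- The functional `-ρ ∫ u v`, controlling `v`. -/
def velocityForm (P : Coeffs) : BilForm State :=
  -(P.ρ • form uL vL)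

/-- The functional `τ ∫∫ (2 - y) z²`, controlling the delay variable. -/
def delayForm (P : Coeffs) : BilForm State :=
  P.τ • ((2 : ℝ) • form zL zL - form zL (mulY.comp zL))

namespace GraphData

variable {P : Coeffs} {U V : State} {uxx φxx z1 : L2} {zy : L2L2} {p₀ p₁ r₀ r₁ : ℝ}

lemma inner_z (h : GraphData P U V uxx φxx z1 zy p₀ p₁ r₀ r₁) :
    2 * ⟪U.z, zy⟫_ℝ = ‖z1‖ ^ 2 - ‖U.ψ‖ ^ 2 := by
  have e : ∀ᵐ x ∂vol01, 2 * ⟪U.z x, zy x⟫_ℝ = z1 x * z1 x - U.ψ x * U.ψ x := by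
    filter_upwards [h.z] with x hx
    have := hx.parts hx
    rw [real_inner_comm (U.z x)] at this
    linarith
  rw [L2L2_inner_eq, ← integral_const_mul, integral_congr_ae e,
    integral_sub (integrable_mul _ _) (integrable_mul _ _), ← inner_eq_integral,
    ← inner_eq_integral, real_inner_self_eq_norm_sq, real_inner_self_eq_norm_sq]

lemma inner_mulY (h : GraphData P U V uxx φxx z1 zy p₀ p₁ r₀ r₁) :
    ⟪zy, mulY U.z⟫_ℝ + ⟪U.z, mulY zy⟫_ℝ + ‖U.z‖ ^ 2 = ‖z1‖ ^ 2 := by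
  have e : ∀ᵐ x ∂vol01, ⟪zy x, mulY U.z x⟫_ℝ + ⟪U.z x, mulY zy x⟫_ℝ + ⟪U.z x, U.z x⟫_ℝ
      = z1 x * z1 x := by
    filter_upwards [h.z, mulX.coeFn_compLpL U.z, mulX.coeFn_compLpL zy] with x hx h1 h2
    rw [← hx.parts_mulX hx]
    unfold mulY
    rw [h1, h2]
  have hi : Integrable (fun x => ⟪zy x, mulY U.z x⟫_ℝ + ⟪U.z x, mulY zy x⟫_ℝ) vol01 :=
    (L2.integrable_inner (𝕜 := ℝ) zy (mulY U.z)).add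
      (L2.integrable_inner (𝕜 := ℝ) U.z (mulY zy))
  rw [← real_inner_self_eq_norm_sq, ← real_inner_self_eq_norm_sq, inner_eq_integral z1 z1,
    ← integral_congr_ae e, L2L2_inner_eq, L2L2_inner_eq, L2L2_inner_eq,
    ← integral_add (L2.integrable_inner (𝕜 := ℝ) _ _) (L2.integrable_inner (𝕜 := ℝ) _ _),
    ← integral_add hi (L2.integrable_inner (𝕜 := ℝ) _ _)]

lemma inner_v (h : GraphData P U V uxx φxx z1 zy p₀ p₁ r₀ r₁) (hP : P.Admissible) (a : L2) :
    P.ρ * ⟪V.v, a⟫_ℝ = P.μ * ⟪uxx, a⟫_ℝ + P.b * ⟪U.φx, a⟫_ℝ := by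
  have := hP.hρ.ne'
  rw [h.eq_v, inner_add_left, real_inner_smul_left, real_inner_smul_left]
  field_simp

lemma inner_ψ (h : GraphData P U V uxx φxx z1 zy p₀ p₁ r₀ r₁) (hP : P.Admissible) (a : L2) :
    P.J * ⟪V.ψ, a⟫_ℝ = P.δ * ⟪φxx, a⟫_ℝ - P.b * ⟪U.ux, a⟫_ℝ - P.ξ * ⟪U.φ, a⟫_ℝ
      - P.μ₁ * ⟪U.ψ, a⟫_ℝ - P.μ₂ * ⟪z1, a⟫_ℝ := by
  have := hP.hJ.ne'
  simp only [h.eq_ψ, inner_sub_left, real_inner_smul_left]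
  field_simp

lemma energyForm_deriv (h : GraphData P U V uxx φxx z1 zy p₀ p₁ r₀ r₁) (hP : P.Admissible) :
    energyForm P U V + energyForm P V U
      = -P.μ₁ * ‖U.ψ‖ ^ 2 - P.μ₂ * ⟪z1, U.ψ⟫_ℝ + P.μ₁ / 2 * (‖U.ψ‖ ^ 2 - ‖z1‖ ^ 2) := by
  have hτ := hP.hτ.ne'
  have h1 := h.ux.parts h.v
  have h2 := h.φ.parts h.v
  have h3 := h.φx.parts h.ψ
  have h4 := h.inner_v hP U.v
  have h5 := h.inner_ψ hP U.ψ
  have h6 := h.inner_z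
  have h7 : P.τ * ⟪V.z, U.z⟫_ℝ = -⟪U.z, zy⟫_ℝ := by
    rw [h.eq_z, inner_neg_left, real_inner_smul_left, real_inner_comm U.z]
    field_simp
  rw [real_inner_self_eq_norm_sq] at h5
  simp only [energyForm, add_apply, smul_apply, form_apply, smul_eq_mul, uxL_apply,
    vL_apply, φL_apply, φxL_apply, ψL_apply, zL_apply, h.eq_φ]
  linear_combination h4 + h5 + P.μ * h1 + P.b * h2 + P.δ * h3 + P.μ₁ * h7 - P.μ₁ / 2 * h6
    + P.ρ / 2 * real_inner_comm V.v U.v + P.J / 2 * real_inner_comm V.ψ U.ψ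
    + P.δ / 2 * real_inner_comm U.φx V.φx + P.μ / 2 * real_inner_comm U.ux V.ux
    + P.b * real_inner_comm U.φ V.ux + P.ξ / 2 * real_inner_comm U.φ U.ψ
    + P.τ * P.μ₁ / 2 * real_inner_comm V.z U.z

lemma phiForm_deriv (h : GraphData P U V uxx φxx z1 zy p₀ p₁ r₀ r₁) (hP : P.Admissible) :
    phiForm P U V + phiForm P V U
      = P.J * ‖U.ψ‖ ^ 2 - P.δ * ‖U.φx‖ ^ 2 - P.ξ * ‖U.φ‖ ^ 2
        + P.b ^ 2 / P.μ * (‖U.φ‖ ^ 2 - ⟪one, U.φ⟫_ℝ ^ 2)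
        - P.μ₁ * ⟪U.ψ, U.φ⟫_ℝ - P.μ₂ * ⟪z1, U.φ⟫_ℝ
        - P.ρ * P.b / P.μ * ⟪U.v, meanFreePrim U.ψ⟫_ℝ := by
  have hμ := hP.hμ.ne'
  have hw := hasTrace_meanFreePrim U.φ
  have h1 := h.φx.parts h.φ
  have h2 := h.ux.parts hw
  have h3 := h.φ.parts hw
  have h4 := h.inner_v hP (meanFreePrim U.φ)
  have h5 := h.inner_ψ hP U.φ
  have h6 : ⟪U.ux, one⟫_ℝ = 0 := by
    rw [real_inner_comm, inner_one]; linarith [h.u.2]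
  rw [inner_sub_right, inner_smul_right, h6] at h2
  rw [inner_sub_right, inner_smul_right, real_inner_comm one U.φ] at h3
  simp only [real_inner_self_eq_norm_sq] at h1 h3 h5
  simp only [phiForm, sub_apply, smul_apply, form_apply, smul_eq_mul, vL_apply, φL_apply,
    ψL_apply, ContinuousLinearMap.comp_apply, h.eq_φ, real_inner_self_eq_norm_sq]
  have e : P.ρ * P.b / P.μ * ⟪V.v, meanFreePrim U.φ⟫_ℝ
      = P.b * ⟪uxx, meanFreePrim U.φ⟫_ℝ + P.b ^ 2 / P.μ * ⟪U.φx, meanFreePrim U.φ⟫_ℝ := by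
    field_simp
    linear_combination P.b * h4
  linear_combination h5 + P.δ * h1 - e - P.b * h2 - P.b ^ 2 / P.μ * h3

lemma crossForm_deriv (h : GraphData P U V uxx φxx z1 zy p₀ p₁ r₀ r₁) (hP : P.Admissible)
    (hspeed : P.ρ / P.μ = P.J / P.δ) :
    crossForm P U V + crossForm P V U
      = P.b * (P.δ * (r₁ * p₁ - r₀ * p₀) - P.b * ‖U.ux‖ ^ 2 - P.ξ * ⟪U.φ, U.ux⟫_ℝ
        - P.μ₁ * ⟪U.ψ, U.ux⟫_ℝ - P.μ₂ * ⟪z1, U.ux⟫_ℝ + P.J * P.b / P.ρ * ‖U.φx‖ ^ 2) := by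
  have hμ := hP.hμ.ne'
  have hρ := hP.hρ.ne'
  have hδ := hP.hδ.ne'
  have h1 := h.ψ.parts h.v
  have h2 := h.φx.parts h.ux
  have h3 := h.inner_ψ hP U.ux
  have h4 := h.inner_v hP U.φx
  have hs : P.J * P.μ = P.ρ * P.δ := by
    field_simp at hspeed
    linarith
  rw [real_inner_self_eq_norm_sq] at h3 h4
  simp only [crossForm, add_apply, smul_apply, form_apply, smul_eq_mul, uxL_apply, vL_apply,
    φxL_apply, ψL_apply]
  have e : P.J * ⟪V.v, U.φx⟫_ℝ = P.δ * ⟪uxx, U.φx⟫_ℝ + P.J * P.b / P.ρ * ‖U.φx‖ ^ 2 := by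
    field_simp
    linear_combination P.J * h4 + ⟪uxx, U.φx⟫_ℝ * hs
  linear_combination P.b * h3 + P.b * P.J * h1 + P.b * P.δ * h2 + P.b * e
    + P.b * P.J * real_inner_comm V.v U.φx + P.b * P.δ * real_inner_comm U.φx uxx

lemma uBoundaryForm_deriv (h : GraphData P U V uxx φxx z1 zy p₀ p₁ r₀ r₁) (hP : P.Admissible) :
    uBoundaryForm P U V + uBoundaryForm P V U
      = P.ρ * ‖U.v‖ ^ 2 + P.μ * ‖U.ux‖ ^ 2 - P.μ / 2 * (p₁ ^ 2 + p₀ ^ 2)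
        + P.b * ⟪U.φx, weightL U.ux⟫_ℝ := by
  have h1 := h.v.inner_weightL
  have h2 := h.ux.inner_weightL
  have h3 := h.inner_v hP (weightL U.ux)
  simp only [uBoundaryForm, smul_apply, form_apply, smul_eq_mul, uxL_apply, vL_apply,
    ContinuousLinearMap.comp_apply]
  linear_combination h3 + P.μ * h2 + P.ρ * h1 + P.ρ * inner_weightL_comm U.v V.ux

lemma phiBoundaryForm_deriv (h : GraphData P U V uxx φxx z1 zy p₀ p₁ r₀ r₁) (hP : P.Admissible) :
    phiBoundaryForm P U V + phiBoundaryForm P V U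
      = P.J * ‖U.ψ‖ ^ 2 + P.δ * ‖U.φx‖ ^ 2 - P.δ / 2 * (r₁ ^ 2 + r₀ ^ 2)
        - P.b * ⟪U.ux, weightL U.φx⟫_ℝ - P.ξ * ⟪U.φ, weightL U.φx⟫_ℝ
        - P.μ₁ * ⟪U.ψ, weightL U.φx⟫_ℝ - P.μ₂ * ⟪z1, weightL U.φx⟫_ℝ := by
  have h1 := h.ψ.inner_weightL
  have h2 := h.φx.inner_weightL
  have h3 := h.inner_ψ hP (weightL U.φx)
  simp only [phiBoundaryForm, smul_apply, form_apply, smul_eq_mul, φxL_apply, ψL_apply,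
    ContinuousLinearMap.comp_apply]
  linear_combination h3 + P.δ * h2 + P.J * h1 + P.J * inner_weightL_comm U.ψ V.φx

lemma velocityForm_deriv (h : GraphData P U V uxx φxx z1 zy p₀ p₁ r₀ r₁) (hP : P.Admissible) :
    velocityForm P U V + velocityForm P V U
      = -P.ρ * ‖U.v‖ ^ 2 + P.μ * ‖U.ux‖ ^ 2 + P.b * ⟪U.φ, U.ux⟫_ℝ := by
  have h1 := h.ux.parts h.u
  have h2 := h.φ.parts h.u
  have h3 := h.inner_v hP U.u
  rw [real_inner_self_eq_norm_sq] at h1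
  simp only [velocityForm, neg_apply, smul_apply, form_apply, smul_eq_mul, uL_apply, vL_apply,
    h.eq_u, real_inner_self_eq_norm_sq]
  linear_combination -h3 - P.μ * h1 - P.b * h2 - P.ρ * real_inner_comm V.v U.u

lemma delayForm_deriv (h : GraphData P U V uxx φxx z1 zy p₀ p₁ r₀ r₁) (hP : P.Admissible) :
    delayForm P U V + delayForm P V U = 2 * ‖U.ψ‖ ^ 2 - ‖z1‖ ^ 2 - ‖U.z‖ ^ 2 := by
  have hτ := hP.hτ.ne'
  have h1 := h.inner_z
  have h2 := h.inner_mulY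
  simp only [delayForm, sub_apply, smul_apply, form_apply, smul_eq_mul, zL_apply,
    ContinuousLinearMap.comp_apply, h.eq_z, map_neg, map_smul, inner_neg_left, inner_neg_right,
    real_inner_smul_left, inner_smul_right]
  rw [real_inner_comm U.z zy]
  field_simp
  linear_combination -2 * h1 + h2

end GraphData

/-! ### The Lyapunov functional of the linear system -/

lemma exists_mul_inner_le {F : Type*} [NormedAddCommGroup F] [InnerProductSpace ℝ F]
    (c : ℝ) {ε : ℝ} (hε : 0 < ε) :
    ∃ C : ℝ, 0 ≤ C ∧ ∀ x y : F, c * ⟪x, y⟫_ℝ ≤ ε * ‖y‖ ^ 2 + C * ‖x‖ ^ 2 := by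
  refine ⟨c ^ 2 / (4 * ε), by positivity, fun x y => ?_⟩
  have h1 : c * ⟪x, y⟫_ℝ ≤ |c| * (‖x‖ * ‖y‖) := by
    calc c * ⟪x, y⟫_ℝ ≤ |c * ⟪x, y⟫_ℝ| := le_abs_self _
      _ = |c| * |⟪x, y⟫_ℝ| := abs_mul _ _
      _ ≤ |c| * (‖x‖ * ‖y‖) := by gcongr; exact abs_real_inner_le_norm x y
  have h2 : 0 ≤ (2 * ε * ‖y‖ - |c| * ‖x‖) ^ 2 / (4 * ε) := by positivity
  have h3 : (2 * ε * ‖y‖ - |c| * ‖x‖) ^ 2 / (4 * ε)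
      = ε * ‖y‖ ^ 2 + c ^ 2 / (4 * ε) * ‖x‖ ^ 2 - |c| * (‖x‖ * ‖y‖) := by
    field_simp
    rw [← sq_abs c]
    ring
  linarith

/-- The part of the Lyapunov functional that controls `uₓ`, `v` and `z`. The coefficients of the
two boundary functionals are chosen such that the boundary terms they produce dominate the product
of the boundary values of `uₓ` and `φₓ` that arises from `crossForm`. -/
def auxForm (P : Coeffs) : BilForm State :=
  crossForm P + (P.b ^ 2 / (12 * P.μ)) • uBoundaryForm P + (12 * P.δ) • phiBoundaryForm P
    + (P.b ^ 2 / (6 * P.μ)) • velocityForm P + delayForm P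

/-- The Lyapunov functional of the linear system. -/
def lyapForm (P : Coeffs) (N N₁ : ℝ) : BilForm State :=
  N • energyForm P + N₁ • phiForm P + auxForm P

lemma State.norm_φ_le (U : State) : ‖U.φ‖ ≤ ‖U.φx‖ := U.hasTrace_φ.norm_le

lemma State.norm_u_le (U : State) : ‖U.u‖ ≤ ‖U.ux‖ := U.hasTrace_u.norm_le

lemma exists_auxForm_deriv_le {P : Coeffs} (hP : P.Admissible) (hspeed : P.ρ / P.μ = P.J / P.δ) :
    ∃ a > 0, ∃ C ≥ 0, ∀ U V uxx φxx z1 zy p₀ p₁ r₀ r₁,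
      GraphData P U V uxx φxx z1 zy p₀ p₁ r₀ r₁ →
      auxForm P U V + auxForm P V U ≤ -a * (‖U.ux‖ ^ 2 + ‖U.v‖ ^ 2 + ‖U.z‖ ^ 2)
        + C * (‖U.φx‖ ^ 2 + ‖U.ψ‖ ^ 2 + ‖z1‖ ^ 2) := by
  have hρ := hP.hρ
  have hμ := hP.hμ
  have hJ := hP.hJ
  have hδ := hP.hδ
  have hb2 : 0 < P.b ^ 2 := by have := hP.hb; positivity
  have hε : 0 < P.b ^ 2 / 16 := by positivity
  set e := P.b ^ 2 / (12 * P.μ) with he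
  have he0 : 0 < e := by positivity
  have heμ : e * P.μ = P.b ^ 2 / 12 := by rw [he]; field_simp
  have he2 : P.b ^ 2 / (6 * P.μ) = 2 * e := by rw [he]; field_simp; ring
  obtain ⟨C1, hC1, k1⟩ := exists_mul_inner_le (F := L2) (-P.b * P.ξ) hε
  obtain ⟨C2, hC2, k2⟩ := exists_mul_inner_le (F := L2) (-P.b * P.μ₁) hε
  obtain ⟨C3, hC3, k3⟩ := exists_mul_inner_le (F := L2) (-P.b * P.μ₂) hε
  obtain ⟨C4, hC4, k4⟩ := exists_mul_inner_le (F := L2) (e * P.b) hε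
  obtain ⟨C5, hC5, k5⟩ := exists_mul_inner_le (F := L2) (-(12 * P.δ) * P.b) hε
  obtain ⟨C6, hC6, k6⟩ := exists_mul_inner_le (F := L2) (2 * e * P.b) hε
  obtain ⟨C7, hC7, k7⟩ := exists_mul_inner_le (F := L2) (-(12 * P.δ) * P.ξ) one_pos
  obtain ⟨C8, hC8, k8⟩ := exists_mul_inner_le (F := L2) (-(12 * P.δ) * P.μ₁) one_pos
  obtain ⟨C9, hC9, k9⟩ := exists_mul_inner_le (F := L2) (-(12 * P.δ) * P.μ₂) one_pos
  set CF := C1 + C4 + C5 + C6 + C7 + 3 + P.J * P.b ^ 2 / P.ρ + 12 * P.δ * P.δ with hCF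
  set CS := C2 + C8 + 12 * P.δ * P.J + 2 with hCS
  set CZ := C3 + C9 with hCZ
  have hCF0 : 0 ≤ CF := by positivity
  have hCS0 : 0 ≤ CS := by positivity
  have hCZ0 : 0 ≤ CZ := by positivity
  refine ⟨min (P.b ^ 2 * (3 / 8)) (min (e * P.ρ) 1), by positivity, CF + CS + CZ, by positivity, ?_⟩
  intro U V uxx φxx z1 zy p₀ p₁ r₀ r₁ h
  have d1 := h.crossForm_deriv hP hspeed
  have d2 := h.uBoundaryForm_deriv hP
  have d3 := h.phiBoundaryForm_deriv hP
  have d4 := h.velocityForm_deriv hP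
  have d5 := h.delayForm_deriv hP
  have hQ : auxForm P U V + auxForm P V U = (crossForm P U V + crossForm P V U)
      + e * (uBoundaryForm P U V + uBoundaryForm P V U)
      + 12 * P.δ * (phiBoundaryForm P U V + phiBoundaryForm P V U)
      + 2 * e * (velocityForm P U V + velocityForm P V U)
      + (delayForm P U V + delayForm P V U) := by
    simp only [auxForm, add_apply, smul_apply, smul_eq_mul, he2, ← he]
    ring
  rw [hQ, d1, d2, d3, d4, d5]
  clear d1 d2 d3 d4 d5 hQ
  have m1 := k1 U.φ U.ux
  have m2 := k2 U.ψ U.ux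
  have m3 := k3 z1 U.ux
  have m4 := k4 U.φx (weightL U.ux)
  have m5 := k5 (weightL U.φx) U.ux
  have m6 := k6 U.φ U.ux
  have m7 := k7 U.φ (weightL U.φx)
  have m8 := k8 U.ψ (weightL U.φx)
  have m9 := k9 z1 (weightL U.φx)
  rw [real_inner_comm U.ux (weightL U.φx)] at m5
  have n1 : ‖U.φ‖ ^ 2 ≤ ‖U.φx‖ ^ 2 := by gcongr; exact U.norm_φ_le
  have n2 : ‖weightL U.ux‖ ^ 2 ≤ ‖U.ux‖ ^ 2 := by gcongr; exact norm_weightL_le _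
  have n3 : ‖weightL U.φx‖ ^ 2 ≤ ‖U.φx‖ ^ 2 := by gcongr; exact norm_weightL_le _
  have o1 := mul_le_mul_of_nonneg_left n1 hC1
  have o2 := mul_le_mul_of_nonneg_left n2 hε.le
  have o3 := mul_le_mul_of_nonneg_left n3 hC5
  have o4 := mul_le_mul_of_nonneg_left n1 hC6
  have o5 := mul_le_mul_of_nonneg_left n1 hC7
  -- the boundary terms combine to `-6 (δ r - b p / 12)²` at either end, up to the sign of `b`
  have q1 : P.b * P.δ * (r₁ * p₁) ≤ P.b ^ 2 / 24 * p₁ ^ 2 + 6 * P.δ ^ 2 * r₁ ^ 2 := by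
    linear_combination 6 * sq_nonneg (P.δ * r₁ - P.b * p₁ / 12)
  have q2 : -(P.b * P.δ * (r₀ * p₀)) ≤ P.b ^ 2 / 24 * p₀ ^ 2 + 6 * P.δ ^ 2 * r₀ ^ 2 := by
    linear_combination 6 * sq_nonneg (P.δ * r₀ + P.b * p₀ / 12)
  have a1 := mul_le_mul_of_nonneg_right (min_le_left (P.b ^ 2 * (3 / 8)) (min (e * P.ρ) 1))
    (sq_nonneg ‖U.ux‖)
  have a2 := mul_le_mul_of_nonneg_right ((min_le_right (P.b ^ 2 * (3 / 8)) (min (e * P.ρ) 1)).trans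
    (min_le_left _ _)) (sq_nonneg ‖U.v‖)
  have a3 := mul_le_mul_of_nonneg_right ((min_le_right (P.b ^ 2 * (3 / 8)) (min (e * P.ρ) 1)).trans
    (min_le_right _ _)) (sq_nonneg ‖U.z‖)
  have f1 : (CF + CS + CZ) * (‖U.φx‖ ^ 2 + ‖U.ψ‖ ^ 2 + ‖z1‖ ^ 2)
      ≥ CF * ‖U.φx‖ ^ 2 + CS * ‖U.ψ‖ ^ 2 + CZ * ‖z1‖ ^ 2 := by
    have : 0 ≤ (CS + CZ) * ‖U.φx‖ ^ 2 + (CF + CZ) * ‖U.ψ‖ ^ 2 + (CF + CS) * ‖z1‖ ^ 2 := by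
      positivity
    linear_combination this
  have f2 : P.b * (P.J * P.b / P.ρ * ‖U.φx‖ ^ 2) = P.J * P.b ^ 2 / P.ρ * ‖U.φx‖ ^ 2 := by
    field_simp
  have g1 : e * (P.μ * ‖U.ux‖ ^ 2) = P.b ^ 2 / 12 * ‖U.ux‖ ^ 2 := by rw [← mul_assoc, heμ]
  have g2 : e * (P.μ / 2 * (p₁ ^ 2 + p₀ ^ 2)) = P.b ^ 2 / 24 * (p₁ ^ 2 + p₀ ^ 2) := by
    linear_combination (p₁ ^ 2 + p₀ ^ 2) / 2 * heμ
  linear_combination m1 + m2 + m3 + m4 + m5 + m6 + m7 + m8 + m9 + o1 + o2 + o3 + o4 + o5 + 3 * n3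
    + q1 + q2 + a1 + a2 + a3 + f1 + f2 + 3 * g1 - g2 + sq_nonneg ‖z1‖
    + ‖U.φx‖ ^ 2 * hCF + ‖U.ψ‖ ^ 2 * hCS + ‖z1‖ ^ 2 * hCZ

lemma exists_phiForm_deriv_le {P : Coeffs} (hP : P.Admissible) {κ : ℝ} (hκ : 0 < κ) :
    ∃ C ≥ 0, ∀ U V uxx φxx z1 zy p₀ p₁ r₀ r₁,
      GraphData P U V uxx φxx z1 zy p₀ p₁ r₀ r₁ →
      phiForm P U V + phiForm P V U ≤ -(P.δ / 2) * ‖U.φx‖ ^ 2 + κ * ‖U.v‖ ^ 2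
        + C * (‖U.ψ‖ ^ 2 + ‖z1‖ ^ 2) := by
  have hμ := hP.hμ
  have hJ := hP.hJ
  have hδ : 0 < P.δ / 4 := by have := hP.hδ; positivity
  obtain ⟨C1, hC1, k1⟩ := exists_mul_inner_le (F := L2) (-P.μ₁) hδ
  obtain ⟨C2, hC2, k2⟩ := exists_mul_inner_le (F := L2) (-P.μ₂) hδ
  obtain ⟨C3, hC3, k3⟩ := exists_mul_inner_le (F := L2) (-(P.ρ * P.b / P.μ)) hκ
  set D := C3 * ‖meanFreePrim‖ ^ 2 with hD
  have hD0 : 0 ≤ D := by positivity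
  refine ⟨P.J + C1 + C2 + D, by positivity, ?_⟩
  intro U V uxx φxx z1 zy p₀ p₁ r₀ r₁ h
  rw [h.phiForm_deriv hP]
  have m1 := k1 U.ψ U.φ
  have m2 := k2 z1 U.φ
  have m3 := k3 (meanFreePrim U.ψ) U.v
  rw [real_inner_comm U.v] at m3
  have n1 : ‖U.φ‖ ^ 2 ≤ ‖U.φx‖ ^ 2 := by gcongr; exact U.norm_φ_le
  have n2 : ‖meanFreePrim U.ψ‖ ^ 2 ≤ ‖meanFreePrim‖ ^ 2 * ‖U.ψ‖ ^ 2 := by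
    rw [← mul_pow]; gcongr; exact meanFreePrim.le_opNorm _
  have n3 := mul_le_mul_of_nonneg_left n2 hC3
  rw [← mul_assoc, ← hD] at n3
  have n4 := mul_le_mul_of_nonneg_left n1 hδ.le
  have n5 : P.b ^ 2 / P.μ * (‖U.φ‖ ^ 2 - ⟪one, U.φ⟫_ℝ ^ 2) ≤ P.ξ * ‖U.φ‖ ^ 2 := by
    have h1 : P.b ^ 2 / P.μ ≤ P.ξ := by
      rw [div_le_iff₀ hμ]; linarith [hP.hb2]
    have h2 : 0 ≤ P.b ^ 2 / P.μ := by positivity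
    nlinarith [mul_le_mul_of_nonneg_right h1 (sq_nonneg ‖U.φ‖),
      mul_nonneg h2 (sq_nonneg ⟪one, U.φ⟫_ℝ)]
  have f1 : (P.J + C1 + C2 + D) * (‖U.ψ‖ ^ 2 + ‖z1‖ ^ 2)
      = P.J * ‖U.ψ‖ ^ 2 + C1 * ‖U.ψ‖ ^ 2 + C2 * ‖z1‖ ^ 2 + D * ‖U.ψ‖ ^ 2
        + ((P.J + C1 + D) * ‖z1‖ ^ 2 + C2 * ‖U.ψ‖ ^ 2) := by ring
  have f2 : 0 ≤ (P.J + C1 + D) * ‖z1‖ ^ 2 + C2 * ‖U.ψ‖ ^ 2 := by positivity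
  linarith

lemma energyForm_deriv_le {P : Coeffs} (hP : P.Admissible) {U V : State} {uxx φxx z1 : L2}
    {zy : L2L2} {p₀ p₁ r₀ r₁ : ℝ} (h : GraphData P U V uxx φxx z1 zy p₀ p₁ r₀ r₁) :
    energyForm P U V + energyForm P V U
      ≤ -((P.μ₁ - P.μ₂) / 2) * (‖U.ψ‖ ^ 2 + ‖z1‖ ^ 2) := by
  have h1 := h.energyForm_deriv hP
  have h2 := neg_le_of_abs_le (abs_real_inner_le_norm z1 U.ψ)
  have h3 : -⟪z1, U.ψ⟫_ℝ ≤ (‖U.ψ‖ ^ 2 + ‖z1‖ ^ 2) / 2 := by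
    nlinarith [sq_nonneg (‖z1‖ - ‖U.ψ‖)]
  have h4 := mul_le_mul_of_nonneg_left h3 hP.hμ₂.le
  linarith

/-- The dissipation estimate of the linear system: any multiple of `‖φₓ‖²` can be absorbed, at the
price of larger weights `N₁` and `N`, while `a` does not change. -/
lemma exists_lyapForm_deriv_le {P : Coeffs} (hP : P.Admissible) (hlt : P.μ₂ < P.μ₁)
    (hspeed : P.ρ / P.μ = P.J / P.δ) :
    ∃ a > 0, ∀ K > 0, ∃ N₀ > 0, ∃ N₁ > 0, ∀ N ≥ N₀, ∀ U V, OperatorGraph P U V →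
      lyapForm P N N₁ U V + lyapForm P N N₁ V U
        ≤ -a * (‖U.ux‖ ^ 2 + ‖U.v‖ ^ 2 + ‖U.z‖ ^ 2 + ‖U.ψ‖ ^ 2) - K * ‖U.φx‖ ^ 2 := by
  have hδ := hP.hδ
  obtain ⟨a, ha, C, hC, hA⟩ := exists_auxForm_deriv_le hP hspeed
  refine ⟨a / 2, by positivity, fun K hK => ?_⟩
  set N₁ := 2 * (C + K) / P.δ with hN₁
  have hN₁0 : 0 < N₁ := by positivity
  obtain ⟨C', hC', hB⟩ := exists_phiForm_deriv_le hP (κ := a / (2 * N₁)) (by positivity)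
  set d := (P.μ₁ - P.μ₂) / 2 with hd
  have hd0 : 0 < d := by rw [hd]; linarith
  refine ⟨(C + N₁ * C' + a) / d, by positivity, N₁, hN₁0, fun N hN U V hUV => ?_⟩
  obtain ⟨uxx, φxx, z1, zy, p₀, p₁, r₀, r₁, h⟩ := hUV.exists_graphData
  have b1 := hA _ _ _ _ _ _ _ _ _ _ h
  have b2 := mul_le_mul_of_nonneg_left (hB _ _ _ _ _ _ _ _ _ _ h) hN₁0.le
  have hN0 : 0 < N := lt_of_lt_of_le (by positivity) hN
  have b3 := mul_le_mul_of_nonneg_left (energyForm_deriv_le hP h) hN0.le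
  rw [← hd] at b3
  have hNd : C + N₁ * C' + a ≤ N * d := by
    rw [ge_iff_le, div_le_iff₀ hd0] at hN; exact hN
  have hs : 0 ≤ ‖U.ψ‖ ^ 2 + ‖z1‖ ^ 2 := by positivity
  have b4 := mul_le_mul_of_nonneg_right hNd hs
  have e1 : N₁ * (P.δ / 2) = C + K := by rw [hN₁]; field_simp
  have e2 : N₁ * (a / (2 * N₁)) = a / 2 := by field_simp
  have hQ : lyapForm P N N₁ U V + lyapForm P N N₁ V U
      = N * (energyForm P U V + energyForm P V U) + N₁ * (phiForm P U V + phiForm P V U)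
        + (auxForm P U V + auxForm P V U) := by
    simp only [lyapForm, add_apply, smul_apply, smul_eq_mul]
    ring
  rw [hQ]
  have e3 : N₁ * (-(P.δ / 2) * ‖U.φx‖ ^ 2 + a / (2 * N₁) * ‖U.v‖ ^ 2
      + C' * (‖U.ψ‖ ^ 2 + ‖z1‖ ^ 2)) = -(C + K) * ‖U.φx‖ ^ 2 + a / 2 * ‖U.v‖ ^ 2
      + N₁ * C' * (‖U.ψ‖ ^ 2 + ‖z1‖ ^ 2) := by
    rw [← e1, ← e2]; ring
  rw [e3] at b2
  have p1 := mul_nonneg ha.le (sq_nonneg ‖U.ux‖)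
  have p2 := mul_nonneg ha.le (sq_nonneg ‖U.v‖)
  have p3 := mul_nonneg ha.le (sq_nonneg ‖U.z‖)
  have p4 := mul_nonneg ha.le (sq_nonneg ‖U.ψ‖)
  have p5 := mul_nonneg ha.le (sq_nonneg ‖z1‖)
  linarith

/-! ### The nonlinear term and its potential -/

/-- The growth and sign conditions on the nonlinearity. -/
structure IsNonlinearity (f : ℝ → ℝ) (k₀ θ : ℝ) : Prop where
  hk₀ : 0 < k₀
  hθ : 0 < θ
  growth : ∀ x y : ℝ, |f x - f y| ≤ k₀ * (|x| ^ θ + |y| ^ θ) * |x - y|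
  sign : ∀ x : ℝ, 0 ≤ primitive f x ∧ primitive f x ≤ f x * x

/-- The potential energy `∫ f̂(a) dx`. -/
def potential (f : ℝ → ℝ) (a : L2) : ℝ := ∫ x in Ioo (0 : ℝ) 1, primitive f (a x)

namespace IsNonlinearity

variable {f : ℝ → ℝ} {k₀ θ : ℝ}

/-- On bounded sets the growth condition is a Lipschitz condition. -/
lemma lipschitz (hf : IsNonlinearity f k₀ θ) {r x y : ℝ} (hx : |x| ≤ r) (hy : |y| ≤ r) :
    |f x - f y| ≤ 2 * k₀ * r ^ θ * |x - y| := by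
  have h1 : |x| ^ θ ≤ r ^ θ := Real.rpow_le_rpow (abs_nonneg _) hx hf.hθ.le
  have h2 : |y| ^ θ ≤ r ^ θ := Real.rpow_le_rpow (abs_nonneg _) hy hf.hθ.le
  have h3 := hf.hk₀
  calc |f x - f y| ≤ k₀ * (|x| ^ θ + |y| ^ θ) * |x - y| := hf.growth x y
    _ ≤ k₀ * (r ^ θ + r ^ θ) * |x - y| := by gcongr
    _ = 2 * k₀ * r ^ θ * |x - y| := by ring

lemma continuous (hf : IsNonlinearity f k₀ θ) : Continuous f := by
  rw [continuous_iff_continuousAt]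
  intro x
  have hev : ∀ᶠ y in 𝓝 x, |f y - f x| ≤ 2 * k₀ * (|x| + 1) ^ θ * |y - x| := by
    filter_upwards [Metric.ball_mem_nhds x one_pos] with y hy
    rw [Metric.mem_ball, Real.dist_eq] at hy
    refine hf.lipschitz ?_ (by linarith)
    have := abs_sub_abs_le_abs_sub y x
    linarith
  rw [ContinuousAt, tendsto_iff_norm_sub_tendsto_zero]
  refine squeeze_zero' (Eventually.of_forall fun _ => norm_nonneg _) hev ?_
  have : Continuous fun y => 2 * k₀ * (|x| + 1) ^ θ * |y - x| := by fun_prop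
  simpa using this.tendsto x

lemma map_zero (hf : IsNonlinearity f k₀ θ) : f 0 = 0 := by
  have hs : ∀ x, 0 ≤ f x * x := fun x => (hf.sign x).1.trans (hf.sign x).2
  have hc := hf.continuous
  apply le_antisymm
  · refine le_of_tendsto ((hc.tendsto 0).mono_left (nhdsWithin_le_nhds (s := Iio 0))) ?_
    filter_upwards [self_mem_nhdsWithin] with x hx
    have hx' : x < 0 := hx
    by_contra! h
    nlinarith [hs x]
  · refine ge_of_tendsto ((hc.tendsto 0).mono_left (nhdsWithin_le_nhds (s := Ioi 0))) ?_
    filter_upwards [self_mem_nhdsWithin] with x hx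
    have hx' : 0 < x := hx
    by_contra! h
    nlinarith [hs x]

lemma abs_le (hf : IsNonlinearity f k₀ θ) {r x : ℝ} (hx : |x| ≤ r) :
    |f x| ≤ 2 * k₀ * r ^ θ * |x| := by
  have := hf.lipschitz hx (y := 0) (by simpa using (abs_nonneg x).trans hx)
  simpa [hf.map_zero] using this

lemma hasDerivAt_primitive (hf : IsNonlinearity f k₀ θ) (x : ℝ) :
    HasDerivAt (primitive f) (f x) x :=
  intervalIntegral.integral_hasDerivAt_right (hf.continuous.intervalIntegrable _ _)
    hf.continuous.stronglyMeasurable.stronglyMeasurableAtFilter hf.continuous.continuousAt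

/-- The first order Taylor remainder of `f̂` on bounded sets. -/
lemma abs_taylor_le (hf : IsNonlinearity f k₀ θ) {r x y : ℝ} (hx : |x| ≤ r) (hy : |y| ≤ r) :
    |primitive f y - primitive f x - f x * (y - x)| ≤ 2 * k₀ * r ^ θ * (y - x) ^ 2 := by
  have hi : ∀ a b, IntervalIntegrable f volume a b := fun a b =>
    hf.continuous.intervalIntegrable a b
  have e : primitive f y - primitive f x - f x * (y - x) = ∫ s in x..y, (f s - f x) := by
    rw [intervalIntegral.integral_sub (hi _ _) (by simp), primitive, primitive,
      intervalIntegral.integral_interval_sub_left (hi _ _) (hi _ _)]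
    simp [mul_comm]
  rw [e]
  have hr : 0 ≤ r := (abs_nonneg x).trans hx
  have hk := hf.hk₀
  have := intervalIntegral.norm_integral_le_of_norm_le_const (a := x) (b := y)
    (C := 2 * k₀ * r ^ θ * |y - x|) (f := fun s => f s - f x) ?_
  · rw [mul_assoc _ |y - x|, abs_mul_abs_self, ← sq] at this
    exact this
  · intro s hs
    have hs' := uIoc_subset_uIcc hs
    have h1 : |s| ≤ r := by
      rw [abs_le'] at *
      rcases le_total x y with h | h
      · rw [uIcc_of_le h] at hs'; constructor <;> linarith [hs'.1, hs'.2, hx.1, hx.2, hy.1, hy.2]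
      · rw [uIcc_of_ge h] at hs'; constructor <;> linarith [hs'.1, hs'.2, hx.1, hx.2, hy.1, hy.2]
    have h2 : |s - x| ≤ |y - x| := abs_sub_left_of_mem_uIcc hs'
    calc ‖f s - f x‖ ≤ 2 * k₀ * r ^ θ * |s - x| := hf.lipschitz h1 hx
      _ ≤ 2 * k₀ * r ^ θ * |y - x| := by gcongr

lemma primitive_le (hf : IsNonlinearity f k₀ θ) {r x : ℝ} (hx : |x| ≤ r) :
    primitive f x ≤ 2 * k₀ * r ^ θ * x ^ 2 := by
  have h1 := hf.abs_le hx
  calc primitive f x ≤ f x * x := (hf.sign x).2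
    _ ≤ |f x| * |x| := by rw [← abs_mul]; exact le_abs_self _
    _ ≤ 2 * k₀ * r ^ θ * |x| * |x| := by gcongr
    _ = 2 * k₀ * r ^ θ * x ^ 2 := by rw [mul_assoc, abs_mul_abs_self, sq]

lemma integrable_primitive (hf : IsNonlinearity f k₀ θ) {r : ℝ} {a : L2}
    (ha : ∀ᵐ x ∂vol01, |a x| ≤ r) : Integrable (fun x => primitive f (a x)) vol01 := by
  have hc : Continuous (primitive f) :=
    continuous_iff_continuousAt.2 fun x => (hf.hasDerivAt_primitive x).continuousAt
  refine Integrable.mono' ((Lp.memLp a).integrable_sq.const_mul (2 * k₀ * r ^ θ))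
    (hc.comp_aestronglyMeasurable (Lp.aestronglyMeasurable a)) ?_
  filter_upwards [ha] with x hx
  rw [Real.norm_of_nonneg (hf.sign _).1]
  exact hf.primitive_le hx

lemma potential_nonneg (hf : IsNonlinearity f k₀ θ) (a : L2) : 0 ≤ potential f a :=
  integral_nonneg fun _ => (hf.sign _).1

lemma potential_le_inner (hf : IsNonlinearity f k₀ θ) {r : ℝ} {a F : L2}
    (ha : ∀ᵐ x ∂vol01, |a x| ≤ r) (hF : (F : ℝ → ℝ) =ᵐ[vol01] fun x => f (a x)) :
    potential f a ≤ ⟪F, a⟫_ℝ := by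
  rw [inner_eq_integral]
  refine integral_mono_ae (hf.integrable_primitive ha) (integrable_mul _ _) ?_
  filter_upwards [hF] with x hx
  rw [hx]
  exact (hf.sign _).2

lemma norm_le (hf : IsNonlinearity f k₀ θ) {r : ℝ} {a F : L2}
    (ha : ∀ᵐ x ∂vol01, |a x| ≤ r) (hF : (F : ℝ → ℝ) =ᵐ[vol01] fun x => f (a x)) :
    ‖F‖ ≤ 2 * k₀ * r ^ θ * ‖a‖ := by
  refine Lp.norm_le_mul_norm_of_ae_le_mul ?_
  filter_upwards [hF, ha] with x h1 h2
  rw [h1]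
  exact hf.abs_le h2

lemma norm_sub_le (hf : IsNonlinearity f k₀ θ) {r : ℝ} {a c F G : L2}
    (ha : ∀ᵐ x ∂vol01, |a x| ≤ r) (hc : ∀ᵐ x ∂vol01, |c x| ≤ r)
    (hF : (F : ℝ → ℝ) =ᵐ[vol01] fun x => f (a x))
    (hG : (G : ℝ → ℝ) =ᵐ[vol01] fun x => f (c x)) :
    ‖G - F‖ ≤ 2 * k₀ * r ^ θ * ‖c - a‖ := by
  refine Lp.norm_le_mul_norm_of_ae_le_mul ?_
  filter_upwards [hF, hG, ha, hc, Lp.coeFn_sub G F, Lp.coeFn_sub c a] with x h1 h2 h3 h4 h5 h6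
  rw [h5, h6, Pi.sub_apply, Pi.sub_apply, h1, h2]
  exact hf.lipschitz h4 h3

lemma abs_potential_sub_le (hf : IsNonlinearity f k₀ θ) {r : ℝ} {a c F : L2}
    (ha : ∀ᵐ x ∂vol01, |a x| ≤ r) (hc : ∀ᵐ x ∂vol01, |c x| ≤ r)
    (hF : (F : ℝ → ℝ) =ᵐ[vol01] fun x => f (a x)) :
    |potential f c - potential f a - ⟪F, c - a⟫_ℝ| ≤ 2 * k₀ * r ^ θ * ‖c - a‖ ^ 2 := by
  have i1 := hf.integrable_primitive ha
  have i2 := hf.integrable_primitive hc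
  have i3 := integrable_mul F (c - a)
  have i12 : Integrable (fun x => primitive f (c x) - primitive f (a x)) vol01 := i2.sub i1
  rw [inner_eq_integral, potential, potential, ← integral_sub i2 i1, ← integral_sub i12 i3,
    norm_sq_eq_integral, ← integral_const_mul]
  refine (abs_integral_le_integral_abs).trans
    (integral_mono_ae (i12.sub i3).abs ((Lp.memLp _).integrable_sq.const_mul _) ?_)
  filter_upwards [hF, ha, hc, Lp.coeFn_sub c a] with x h1 h2 h3 h4
  simp only [Pi.sub_apply, h1, h4]
  exact hf.abs_taylor_le h2 h3

end IsNonlinearity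

/-! ### Mild solutions of the nonlinear system -/

/-- The inclusion of `L²(0,1)` as the component `ψ` of the energy space. -/
def inclψ : L2 →L[ℝ] State :=
  (ContinuousLinearMap.inr ℝ H10 (L2 × H10 × L2 × L2L2)).comp
    ((ContinuousLinearMap.inr ℝ L2 (H10 × L2 × L2L2)).comp
      ((ContinuousLinearMap.inr ℝ H10 (L2 × L2L2)).comp (ContinuousLinearMap.inl ℝ L2 L2L2)))

lemma ForcingGraph.eq_inclψ {P : Coeffs} {f : ℝ → ℝ} {U W : State} (h : ForcingGraph P f U W) :
    W = inclψ W.ψ := by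
  obtain ⟨h1, h2, h3, h4, h5, -, h7⟩ := h
  refine Prod.ext (Subtype.ext (Prod.ext h1 h2)) (Prod.ext h3 (Prod.ext
    (Subtype.ext (Prod.ext h4 h5)) (Prod.ext rfl h7)))

lemma ForcingGraph.ae_eq {P : Coeffs} (hP : P.Admissible) {f : ℝ → ℝ} {U W : State}
    (h : ForcingGraph P f U W) :
    ((-P.J • W.ψ : L2) : ℝ → ℝ) =ᵐ[vol01] fun x => f (U.φ x) := by
  have hJ := hP.hJ.ne'
  filter_upwards [h.2.2.2.2.2.1, Lp.coeFn_smul (-P.J) W.ψ] with x h1 h2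
  rw [h2, Pi.smul_apply, h1, smul_eq_mul]
  field_simp

lemma State.ae_abs_φ_le (U : State) {r : ℝ} (h : ‖U.φx‖ ≤ r) : ∀ᵐ x ∂vol01, |U.φ x| ≤ r :=
  U.hasTrace_φ.ae_abs_le.mono fun _ hx => hx.trans h

/-- A mild solution of the nonlinear system together with its semigroup and forcing. -/
structure Solution (P : Coeffs) (f : ℝ → ℝ) (S : ℝ → State →L[ℝ] State) (G U : ℝ → State) :
    Prop where
  cont : ContinuousOn U (Ici 0)
  generated : GeneratedByOperator P S
  forcing : ∀ s, 0 ≤ s → ForcingGraph P f (U s) (G s)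
  mild : IsMild S G U

section

variable {P : Coeffs} {f : ℝ → ℝ} {k₀ θ : ℝ} {S : ℝ → State →L[ℝ] State} {G U : ℝ → State}

/-- Near any time `‖φₓ‖` is bounded, and hence `φ` is bounded uniformly in space. -/
lemma eventually_norm_φx_le (hU : ContinuousOn U (Ici 0)) {t : ℝ} (ht : 0 ≤ t) :
    ∀ᶠ s in 𝓝[≥] t, ‖(U s).φx‖ ≤ ‖(U t).φx‖ + 1 := by
  have h1 : ContinuousWithinAt (fun s => ‖φxL (U s)‖) (Ici t) t :=
    ((φxL.continuous.norm).comp_continuousOn hU t ht).mono (Ici_subset_Ici.2 ht)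
  filter_upwards [h1.tendsto.eventually (gt_mem_nhds (lt_add_one _))] with s hs
  exact hs.le

lemma forcing_rightCont (hP : P.Admissible) (hf : IsNonlinearity f k₀ θ)
    (hU : ContinuousOn U (Ici 0)) (hG : ∀ s, 0 ≤ s → ForcingGraph P f (U s) (G s)) {t : ℝ}
    (ht : 0 ≤ t) : ContinuousWithinAt G (Ici t) t := by
  have hJ := hP.hJ
  set K := 2 * k₀ * (‖(U t).φx‖ + 1) ^ θ with hK
  have hψ : ContinuousWithinAt (fun s => -P.J • (G s).ψ) (Ici t) t := by
    rw [ContinuousWithinAt, tendsto_iff_norm_sub_tendsto_zero]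
    have hφ : Tendsto (fun s => K * ‖(U s).φ - (U t).φ‖) (𝓝[≥] t) (𝓝 0) := by
      have h1 : ContinuousWithinAt (fun s => φL (U s)) (Ici t) t :=
        (φL.continuous.comp_continuousOn hU t ht).mono (Ici_subset_Ici.2 ht)
      have h2 := (tendsto_iff_norm_sub_tendsto_zero.1 h1.tendsto).const_mul K
      rwa [mul_zero] at h2
    refine squeeze_zero' (Eventually.of_forall fun _ => norm_nonneg _) ?_ hφ
    filter_upwards [eventually_norm_φx_le hU ht, self_mem_nhdsWithin] with s hs hts
    exact hf.norm_sub_le ((U t).ae_abs_φ_le (by linarith)) ((U s).ae_abs_φ_le hs)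
      ((hG t ht).ae_eq hP) ((hG s (ht.trans hts)).ae_eq hP)
  have h1 : ContinuousWithinAt (fun s => inclψ ((-P.J)⁻¹ • (-P.J • (G s).ψ))) (Ici t) t :=
    (inclψ.continuous.comp (continuous_const_smul _)).continuousAt.comp_continuousWithinAt hψ
  have h2 : ∀ s, 0 ≤ s → G s = inclψ ((-P.J)⁻¹ • (-P.J • (G s).ψ)) := by
    intro s hs
    rw [smul_smul, inv_mul_cancel₀ (neg_ne_zero.2 hJ.ne'), one_smul]
    exact (hG s hs).eq_inclψ
  exact h1.congr (fun s hs => h2 s (ht.trans hs)) (h2 t ht)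

lemma IsMildSolution.exists_solution (hP : P.Admissible) (hf : IsNonlinearity f k₀ θ)
    (hU : IsMildSolution P f U) : ∃ S G, Solution P f S G U := by
  obtain ⟨hc, S, hS, hgen, G, hG, hm⟩ := hU
  exact ⟨S, G, hc, hgen, hG, ⟨hS.zero, hS.add, hS.tendsto_zero⟩, fun t ht => (hm t ht).1,
    fun t ht => (hm t ht).2, fun t ht => forcing_rightCont hP hf hc hG ht⟩

namespace Solution

/-- The nonlinear term `f(φ(t))` as an element of `L²(0,1)`, read off from the forcing. -/
def nonlin (P : Coeffs) (G : ℝ → State) (t : ℝ) : L2 := -P.J • (G t).ψ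

lemma nonlin_ae (hP : P.Admissible) (h : Solution P f S G U) {t : ℝ} (ht : 0 ≤ t) :
    (nonlin P G t : ℝ → ℝ) =ᵐ[vol01] fun x => f ((U t).φ x) := (h.forcing t ht).ae_eq hP

lemma hasDerivWithinAt_φ (h : Solution P f S G U) {t : ℝ} (ht : 0 ≤ t) :
    HasDerivWithinAt (fun s => (U s).φ) (U t).ψ (Ici t) t := by
  have h1 := h.mild.hasDerivWithinAt_linear φL ψL ?_ ht
  · have h2 : φL (G t) = 0 := (h.forcing t ht).2.2.2.1
    rw [h2, add_zero] at h1
    exact h1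
  · intro U V hUV
    obtain ⟨_, _, _, _, -, -, -, -, -, -, h7, -⟩ := (h.generated U V).1 hUV
    exact h7

/-- The chain rule for the potential energy along a solution. -/
lemma hasDerivWithinAt_potential (hP : P.Admissible) (hf : IsNonlinearity f k₀ θ)
    (h : Solution P f S G U) {t : ℝ} (ht : 0 ≤ t) :
    HasDerivWithinAt (fun s => potential f (U s).φ) ⟪nonlin P G t, (U t).ψ⟫_ℝ (Ici t) t := by
  have hφ := hasDerivWithinAt_Ici_iff_tendsto.1 (h.hasDerivWithinAt_φ ht)
  rw [hasDerivWithinAt_Ici_iff_tendsto]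
  set K := 2 * k₀ * (‖(U t).φx‖ + 1) ^ θ with hK
  set F := nonlin P G t with hF
  have h1 : Tendsto (fun k : ℝ => ⟪F, k⁻¹ • ((U (t + k)).φ - (U t).φ)⟫_ℝ) (𝓝[>] 0)
      (𝓝 ⟪F, (U t).ψ⟫_ℝ) := tendsto_const_nhds.inner hφ
  have hid : Tendsto (fun k : ℝ => k) (𝓝[>] (0 : ℝ)) (𝓝 0) := nhdsWithin_le_nhds
  have h2 : Tendsto (fun k : ℝ => K * (k * ‖k⁻¹ • ((U (t + k)).φ - (U t).φ)‖ ^ 2)) (𝓝[>] 0)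
      (𝓝 0) := by
    have := (hid.mul (hφ.norm.pow 2)).const_mul K
    simpa using this
  have hev : ∀ᶠ k in 𝓝[>] (0 : ℝ), ‖(U (t + k)).φx‖ ≤ ‖(U t).φx‖ + 1 := by
    have ht' : Tendsto (fun k : ℝ => t + k) (𝓝[>] 0) (𝓝[≥] t) := by
      refine tendsto_nhdsWithin_iff.2 ⟨by simpa using hid.const_add t, ?_⟩
      filter_upwards [self_mem_nhdsWithin] with k hk
      have hk' : 0 < k := hk
      simp [hk'.le]
    exact ht'.eventually (eventually_norm_φx_le h.cont ht)
  have h3 : Tendsto (fun k : ℝ => k⁻¹ • (potential f (U (t + k)).φ - potential f (U t).φ)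
      - ⟪F, k⁻¹ • ((U (t + k)).φ - (U t).φ)⟫_ℝ) (𝓝[>] 0) (𝓝 0) := by
    refine squeeze_zero_norm' ?_ h2
    filter_upwards [hev, self_mem_nhdsWithin] with k hk hk0
    have hk0' : 0 < k := hk0
    have h4 := hf.abs_potential_sub_le ((U t).ae_abs_φ_le (by linarith)) ((U (t + k)).ae_abs_φ_le hk)
      (h.nonlin_ae hP ht)
    rw [inner_smul_right, smul_eq_mul, ← mul_sub, norm_mul, norm_smul, norm_inv,
      Real.norm_of_nonneg hk0'.le, Real.norm_eq_abs]
    calc k⁻¹ * |potential f (U (t + k)).φ - potential f (U t).φ - ⟪F, (U (t + k)).φ - (U t).φ⟫_ℝ|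
        ≤ k⁻¹ * (K * ‖(U (t + k)).φ - (U t).φ‖ ^ 2) := by gcongr
      _ = K * (k * (k⁻¹ * ‖(U (t + k)).φ - (U t).φ‖) ^ 2) := by field_simp
  simpa using h3.add h1

lemma continuousOn_potential (hf : IsNonlinearity f k₀ θ) (hP : P.Admissible)
    (h : Solution P f S G U) : ContinuousOn (fun s => potential f (U s).φ) (Ici 0) := by
  intro t ht
  have ht' : 0 ≤ t := ht
  set K := 2 * k₀ * (‖(U t).φx‖ + 1) ^ θ with hK
  set F := nonlin P G t with hF
  have hφ : ContinuousWithinAt (fun s => φL (U s) - φL (U t)) (Ici 0) t :=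
    (φL.continuous.comp_continuousOn h.cont t ht).sub continuousWithinAt_const
  have hev : ∀ᶠ s in 𝓝[Ici 0] t, ‖(U s).φx‖ ≤ ‖(U t).φx‖ + 1 := by
    have h1 : ContinuousWithinAt (fun s => ‖φxL (U s)‖) (Ici 0) t :=
      (φxL.continuous.norm).comp_continuousOn h.cont t ht
    filter_upwards [h1.tendsto.eventually (gt_mem_nhds (lt_add_one _))] with s hs
    exact hs.le
  rw [ContinuousWithinAt, tendsto_iff_norm_sub_tendsto_zero]
  have hlim : Tendsto (fun s => K * ‖(U s).φ - (U t).φ‖ ^ 2 + ‖F‖ * ‖(U s).φ - (U t).φ‖)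
      (𝓝[Ici 0] t) (𝓝 0) := by
    have h0 : Tendsto (fun s => ‖(U s).φ - (U t).φ‖) (𝓝[Ici 0] t) (𝓝 0) := by
      have := hφ.norm.tendsto
      simpa [φL_apply] using this
    simpa using ((h0.pow 2).const_mul K).add (h0.const_mul ‖F‖)
  refine squeeze_zero' (Eventually.of_forall fun _ => norm_nonneg _) ?_ hlim
  filter_upwards [hev] with s hs
  have h4 := hf.abs_potential_sub_le ((U t).ae_abs_φ_le (by linarith)) ((U s).ae_abs_φ_le hs)
    (h.nonlin_ae hP ht')
  have h5 := abs_real_inner_le_norm F ((U s).φ - (U t).φ)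
  have h6 := abs_add_le (potential f (U s).φ - potential f (U t).φ - ⟪F, (U s).φ - (U t).φ⟫_ℝ)
    ⟪F, (U s).φ - (U t).φ⟫_ℝ
  rw [sub_add_cancel] at h6
  exact h6.trans (add_le_add h4 h5)

/-- The upper right Dini derivative of a quadratic form plus a multiple of the potential energy. -/
lemma frequently_slope_lt (hP : P.Admissible) (hf : IsNonlinearity f k₀ θ)
    (h : Solution P f S G U) (B : BilForm State) (q : State → ℝ) (hq : Continuous q)
    (hBq : ∀ U V, OperatorGraph P U V → B U V + B V U ≤ q U) (N : ℝ) {t : ℝ} (ht : 0 ≤ t) {c : ℝ}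
    (hc : q (U t) + B (U t) (G t) + B (G t) (U t) + N * ⟪nonlin P G t, (U t).ψ⟫_ℝ < c) :
    ∃ᶠ s in 𝓝[>] t, slope (fun s => B (U s) (U s) + N * potential f (U s).φ) t s < c := by
  obtain ⟨c₁, h1, h2⟩ := exists_between
    (show q (U t) + B (U t) (G t) + B (G t) (U t) < c - N * ⟪nonlin P G t, (U t).ψ⟫_ℝ by linarith)
  have k1 := h.mild.eventually_quadratic_lt B q hq
    (fun U V hUV => hBq U V ((h.generated U V).1 hUV))
    ht h1
  have k2 := (hasDerivWithinAt_Ici_iff_tendsto.1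
    ((h.hasDerivWithinAt_potential hP hf ht).const_mul N)).eventually
    (gt_mem_nhds (show _ < c - c₁ by linarith))
  refine Eventually.frequently ?_
  rw [show 𝓝[>] t = map (fun k => t + k) (𝓝[>] (0 : ℝ)) by simp, eventually_map]
  filter_upwards [k1, k2, self_mem_nhdsWithin] with k m1 m2 hk
  have hk0 : 0 < k := hk
  rw [smul_eq_mul, inv_mul_lt_iff₀ hk0] at m2
  rw [slope_def_field, add_sub_cancel_left, div_lt_iff₀ hk0]
  linarith

end Solution

end

/-! ### Exponential decay -/

/-- The square of a Hilbert norm on the energy space, without weights. -/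
def State.normSq (U : State) : ℝ := ‖U.ux‖ ^ 2 + ‖U.v‖ ^ 2 + ‖U.φx‖ ^ 2 + ‖U.ψ‖ ^ 2 + ‖U.z‖ ^ 2

lemma State.normSq_nonneg (U : State) : 0 ≤ U.normSq := by unfold State.normSq; positivity

lemma State.norm_sq_le (U : State) : ‖U‖ ^ 2 ≤ U.normSq := by
  have h1 := sq_nonneg ‖U.ux‖
  have h2 := sq_nonneg ‖U.v‖
  have h3 := sq_nonneg ‖U.φx‖
  have h4 := sq_nonneg ‖U.ψ‖
  have h5 := sq_nonneg ‖U.z‖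
  have hle : ∀ x : ℝ, 0 ≤ x → x ^ 2 ≤ U.normSq → x ≤ √U.normSq := fun x hx hxs =>
    Real.le_sqrt_of_sq_le hxs
  have key : ‖U‖ ≤ √U.normSq := by
    have a1 : ‖U.ux‖ ≤ √U.normSq := hle _ (norm_nonneg _) (by unfold State.normSq; linarith)
    have a2 : ‖U.v‖ ≤ √U.normSq := hle _ (norm_nonneg _) (by unfold State.normSq; linarith)
    have a3 : ‖U.φx‖ ≤ √U.normSq := hle _ (norm_nonneg _) (by unfold State.normSq; linarith)
    have a4 : ‖U.ψ‖ ≤ √U.normSq := hle _ (norm_nonneg _) (by unfold State.normSq; linarith)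
    have a5 : ‖U.z‖ ≤ √U.normSq := hle _ (norm_nonneg _) (by unfold State.normSq; linarith)
    exact max_le (max_le (U.norm_u_le.trans a1) a1) (max_le a2 (max_le
      (max_le (U.norm_φ_le.trans a3) a3) (max_le a4 a5)))
  calc ‖U‖ ^ 2 ≤ √U.normSq ^ 2 := by gcongr
    _ = U.normSq := Real.sq_sqrt U.normSq_nonneg

lemma exists_abs_form_le (B : BilForm State) :
    ∃ C : ℝ, 0 ≤ C ∧ ∀ U : State, |B U U| ≤ C * U.normSq := by
  refine ⟨‖B‖, B.opNorm_nonneg, fun U => ?_⟩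
  calc |B U U| ≤ ‖B‖ * ‖U‖ * ‖U‖ := B.le_opNorm₂ U U
    _ = ‖B‖ * ‖U‖ ^ 2 := by ring
    _ ≤ ‖B‖ * U.normSq := mul_le_mul_of_nonneg_left U.norm_sq_le B.opNorm_nonneg

/-- Coercivity of the linear energy; `b² ≤ μ ξ` makes the form in `(uₓ, φ)` nonnegative, and
`δ ‖φₓ‖²` repairs its possible degeneracy. -/
lemma exists_le_energyForm {P : Coeffs} (hP : P.Admissible) :
    ∃ c > 0, ∀ U : State, c * U.normSq ≤ energyForm P U U := by
  have hρ := hP.hρ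
  have hμ := hP.hμ
  have hJ := hP.hJ
  have hδ := hP.hδ
  have hτ := hP.hτ
  have hμ₁ := hP.hμ₁
  set k := P.b / P.μ with hk
  set s := min (P.μ / 4) (P.δ / (8 * (k ^ 2 + 1))) with hs
  have hs0 : 0 < s := by positivity
  have hs1 : s ≤ P.μ / 4 := min_le_left _ _
  have hs2 : s * (8 * (k ^ 2 + 1)) ≤ P.δ := by
    rw [← le_div_iff₀ (by positivity)]; exact min_le_right _ _
  set c := min s (min (P.ρ / 2) (min (P.δ / 4) (min (P.J / 2) (P.τ * P.μ₁ / 2)))) with hc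
  have c1 : c ≤ s := min_le_left _ _
  have c2 : c ≤ P.ρ / 2 := (min_le_right _ _).trans (min_le_left _ _)
  have c3 : c ≤ P.δ / 4 := ((min_le_right _ _).trans (min_le_right _ _)).trans (min_le_left _ _)
  have c4 : c ≤ P.J / 2 := (((min_le_right _ _).trans (min_le_right _ _)).trans
    (min_le_right _ _)).trans (min_le_left _ _)
  have c5 : c ≤ P.τ * P.μ₁ / 2 := (((min_le_right _ _).trans (min_le_right _ _)).trans
    (min_le_right _ _)).trans (min_le_right _ _)
  refine ⟨c, by positivity, fun U => ?_⟩
  simp only [energyForm, add_apply, smul_apply, form_apply, smul_eq_mul, uxL_apply, vL_apply,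
    φL_apply, φxL_apply, ψL_apply, zL_apply, real_inner_self_eq_norm_sq]
  have e1 : ‖U.ux + k • U.φ‖ ^ 2 = ‖U.ux‖ ^ 2 + 2 * (k * ⟪U.ux, U.φ⟫_ℝ) + k ^ 2 * ‖U.φ‖ ^ 2 := by
    rw [norm_add_sq_real, inner_smul_right, norm_smul, mul_pow, Real.norm_eq_abs, sq_abs]
  have e2 : P.μ / 2 * ‖U.ux‖ ^ 2 + P.b * ⟪U.ux, U.φ⟫_ℝ + P.ξ / 2 * ‖U.φ‖ ^ 2
      ≥ P.μ / 2 * ‖U.ux + k • U.φ‖ ^ 2 := by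
    have hb : P.μ * k = P.b := by rw [hk]; field_simp
    have hξ : P.μ * k ^ 2 ≤ P.ξ := by
      have : P.μ * k ^ 2 = P.b ^ 2 / P.μ := by rw [hk]; field_simp
      rw [this, div_le_iff₀ hμ]; linarith [hP.hb2]
    have := mul_le_mul_of_nonneg_right hξ (sq_nonneg ‖U.φ‖)
    rw [e1, ← hb]
    linarith
  have e3 : ‖U.ux‖ ^ 2 ≤ 2 * ‖U.ux + k • U.φ‖ ^ 2 + 2 * (k ^ 2 * ‖U.φx‖ ^ 2) := by
    have h1 : ‖U.ux‖ ≤ ‖U.ux + k • U.φ‖ + |k| * ‖U.φx‖ := by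
      calc ‖U.ux‖ = ‖(U.ux + k • U.φ) - k • U.φ‖ := by rw [add_sub_cancel_right]
        _ ≤ ‖U.ux + k • U.φ‖ + ‖k • U.φ‖ := norm_sub_le _ _
        _ ≤ ‖U.ux + k • U.φ‖ + |k| * ‖U.φx‖ := by
          rw [norm_smul, Real.norm_eq_abs]; gcongr; exact U.norm_φ_le
    have h2 : ‖U.ux‖ ^ 2 ≤ (‖U.ux + k • U.φ‖ + |k| * ‖U.φx‖) ^ 2 := by gcongr
    have h3 := sq_nonneg (‖U.ux + k • U.φ‖ - |k| * ‖U.φx‖)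
    rw [← sq_abs k]
    linarith
  have e4 := mul_le_mul_of_nonneg_left e3 hs0.le
  have e5 := mul_le_mul_of_nonneg_right hs1 (sq_nonneg ‖U.ux + k • U.φ‖)
  have e6 := mul_le_mul_of_nonneg_right hs2 (sq_nonneg ‖U.φx‖)
  have e7 := mul_nonneg hs0.le (sq_nonneg ‖U.φx‖)
  have d1 := mul_le_mul_of_nonneg_right c1 (sq_nonneg ‖U.ux‖)
  have d2 := mul_le_mul_of_nonneg_right c2 (sq_nonneg ‖U.v‖)
  have d3 := mul_le_mul_of_nonneg_right c3 (sq_nonneg ‖U.φx‖)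
  have d4 := mul_le_mul_of_nonneg_right c4 (sq_nonneg ‖U.ψ‖)
  have d5 := mul_le_mul_of_nonneg_right c5 (sq_nonneg ‖U.z‖)
  unfold State.normSq
  linarith

/-- The energy with the weight `τ μ₁` for the delay variable. -/
def totalEnergy (P : Coeffs) (f : ℝ → ℝ) (U : State) : ℝ := energyForm P U U + potential f U.φ

lemma energy_eq {P : Coeffs} {f : ℝ → ℝ} {k₀ θ : ℝ} (hf : IsNonlinearity f k₀ θ) (η : ℝ)
    (U : State) :
    energy P f η U = totalEnergy P f U + (η - P.τ * P.μ₁) / 2 * ‖U.z‖ ^ 2 := by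
  have hz : ∫ x in Ioo (0 : ℝ) 1, ∫ y in Ioo (0 : ℝ) 1, (U.z x y) ^ 2 = ‖U.z‖ ^ 2 := by
    rw [← real_inner_self_eq_norm_sq, L2L2_inner_eq]
    refine integral_congr_ae (Eventually.of_forall fun x => ?_)
    simp only [real_inner_self_eq_norm_sq, norm_sq_eq_integral]
  have i1 := (Lp.memLp U.v).integrable_sq.const_mul P.ρ
  have i2 := (Lp.memLp U.ψ).integrable_sq.const_mul P.J
  have i3 := (Lp.memLp U.φx).integrable_sq.const_mul P.δ
  have i4 := (Lp.memLp U.ux).integrable_sq.const_mul P.μ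
  have i5 : Integrable (fun x => 2 * P.b * U.ux x * U.φ x) vol01 :=
    ((integrable_mul U.ux U.φ).const_mul (2 * P.b)).congr
      (Eventually.of_forall fun x => by simp only; ring)
  have i6 := (Lp.memLp U.φ).integrable_sq.const_mul P.ξ
  have i7 := (hf.integrable_primitive (U.ae_abs_φ_le le_rfl)).const_mul 2
  have e5 : ∫ x in Ioo (0 : ℝ) 1, 2 * P.b * U.ux x * U.φ x = 2 * P.b * ⟪U.ux, U.φ⟫_ℝ := by
    rw [inner_eq_integral, ← integral_const_mul]
    exact integral_congr_ae (Eventually.of_forall fun x => by simp only; ring)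
  have hadd : ∀ {g k : ℝ → ℝ}, Integrable g vol01 → Integrable k vol01 →
      Integrable (fun x => g x + k x) vol01 := fun hg hk => hg.add hk
  have j2 := hadd i1 i2
  have j3 := hadd j2 i3
  have j4 := hadd j3 i4
  have j5 := hadd j4 i5
  unfold energy
  rw [hz, integral_add (hadd j5 i6) i7, integral_add j5 i6, integral_add j4 i5,
    integral_add j3 i4, integral_add j2 i3, integral_add i1 i2, e5]
  simp only [integral_const_mul, ← norm_sq_eq_integral, totalEnergy, potential, energyForm,
    add_apply, smul_apply, form_apply, smul_eq_mul, uxL_apply, vL_apply,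
    φL_apply, φxL_apply, ψL_apply, zL_apply, real_inner_self_eq_norm_sq]
  ring

namespace Solution

variable {P : Coeffs} {f : ℝ → ℝ} {k₀ θ : ℝ} {S : ℝ → State →L[ℝ] State} {G U : ℝ → State}

lemma continuousOn_form (h : Solution P f S G U) (B : BilForm State) :
    ContinuousOn (fun t => B (U t) (U t)) (Ici 0) :=
  B.isBoundedBilinearMap.continuous.comp_continuousOn (h.cont.prodMk h.cont)

lemma inner_forcing (t : ℝ) (a : L2) : P.J * ⟪(G t).ψ, a⟫_ℝ = -⟪nonlin P G t, a⟫_ℝ := by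
  rw [nonlin, real_inner_smul_left]; ring

lemma energyForm_forcing (h : Solution P f S G U) {t : ℝ} (ht : 0 ≤ t) :
    energyForm P (U t) (G t) + energyForm P (G t) (U t) = -⟪nonlin P G t, (U t).ψ⟫_ℝ := by
  rw [← inner_forcing]
  obtain ⟨h1, h2, h3, h4, h5, -, h7⟩ := h.forcing t ht
  simp only [energyForm, add_apply, smul_apply, form_apply, smul_eq_mul, uxL_apply, vL_apply,
    φL_apply, φxL_apply, ψL_apply, zL_apply, h2, h3, h4, h5, h7, inner_zero_left, inner_zero_right]
  linear_combination P.J / 2 * real_inner_comm (G t).ψ (U t).ψ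

/-- The energy does not increase. -/
lemma totalEnergy_le (hP : P.Admissible) (hlt : P.μ₂ < P.μ₁) (hf : IsNonlinearity f k₀ θ)
    (h : Solution P f S G U) {s t : ℝ} (hs : 0 ≤ s) (hst : s ≤ t) :
    totalEnergy P f (U t) ≤ totalEnergy P f (U s) := by
  have hc : ContinuousOn (fun t => energyForm P (U t) (U t) + 1 * potential f (U t).φ) (Icc s t) :=
    ((h.continuousOn_form _).add (continuousOn_const.mul (h.continuousOn_potential hf hP))).mono
      fun x hx => hs.trans hx.1
  have hB : ∀ U V, OperatorGraph P U V → energyForm P U V + energyForm P V U ≤ 0 := by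
    intro U V hUV
    obtain ⟨uxx, φxx, z1, zy, p₀, p₁, r₀, r₁, hg⟩ := hUV.exists_graphData
    refine (energyForm_deriv_le hP hg).trans ?_
    have : 0 ≤ (P.μ₁ - P.μ₂) / 2 * (‖U.ψ‖ ^ 2 + ‖z1‖ ^ 2) :=
      mul_nonneg (by linarith) (by positivity)
    linarith
  have := image_le_of_liminf_slope_right_le_deriv_boundary hc
    (B := fun _ => energyForm P (U s) (U s) + 1 * potential f (U s).φ) (B' := fun _ => 0)
    le_rfl continuousOn_const (fun x _ => hasDerivWithinAt_const _ _ _) ?_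
    (right_mem_Icc.2 hst)
  · simpa [totalEnergy] using this
  · intro x hx r hr
    have hx0 : 0 ≤ x := hs.trans hx.1
    refine h.frequently_slope_lt hP hf _ (fun _ => 0) continuous_const hB 1 hx0 ?_
    linarith [h.energyForm_forcing hx0]

lemma lyapForm_forcing (h : Solution P f S G U) (N N₁ : ℝ) {t : ℝ} (ht : 0 ≤ t) :
    lyapForm P N N₁ (U t) (G t) + lyapForm P N N₁ (G t) (U t)
      = -N * ⟪nonlin P G t, (U t).ψ⟫_ℝ - N₁ * ⟪nonlin P G t, (U t).φ⟫_ℝ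
        - P.b * ⟪nonlin P G t, (U t).ux⟫_ℝ
        - 12 * P.δ * ⟪nonlin P G t, weightL (U t).φx⟫_ℝ := by
  have e0 := h.energyForm_forcing ht
  have e1 := inner_forcing (P := P) (G := G) t (U t).φ
  have e2 := inner_forcing (P := P) (G := G) t (U t).ux
  have e3 := inner_forcing (P := P) (G := G) t (weightL (U t).φx)
  obtain ⟨h1, h2, h3, h4, h5, -, h7⟩ := h.forcing t ht
  have hφ : phiForm P (U t) (G t) + phiForm P (G t) (U t) = -⟪nonlin P G t, (U t).φ⟫_ℝ := by
    simp only [phiForm, sub_apply, smul_apply, form_apply, smul_eq_mul, vL_apply, φL_apply,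
      ψL_apply, ContinuousLinearMap.comp_apply, h3, h4, _root_.map_zero, inner_zero_left,
      inner_zero_right]
    linear_combination e1
  have haux : auxForm P (U t) (G t) + auxForm P (G t) (U t) = -P.b * ⟪nonlin P G t, (U t).ux⟫_ℝ
      - 12 * P.δ * ⟪nonlin P G t, weightL (U t).φx⟫_ℝ := by
    simp only [auxForm, crossForm, uBoundaryForm, phiBoundaryForm, velocityForm, delayForm,
      sub_apply, add_apply, neg_apply, smul_apply, form_apply, smul_eq_mul, uL_apply, uxL_apply,
      vL_apply, φxL_apply, ψL_apply, zL_apply, ContinuousLinearMap.comp_apply,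
      h1, h2, h3, h5, h7, _root_.map_zero, inner_zero_left, inner_zero_right]
    linear_combination P.b * e2 + 12 * P.δ * e3
  simp only [lyapForm, add_apply, smul_apply, smul_eq_mul]
  linear_combination N * e0 + N₁ * hφ + haux

end Solution

namespace Solution

variable {P : Coeffs} {f : ℝ → ℝ} {k₀ θ : ℝ}

/-- The Lyapunov functional `B U U + N ∫ f̂(φ)` adapted to states with `‖φₓ‖ ≤ r`: it is comparable
to the energy, and its Dini derivative along solutions is at most `-2γ` times its value. -/
lemma exists_lyapunov (hP : P.Admissible) (hlt : P.μ₂ < P.μ₁) (hspeed : P.ρ / P.μ = P.J / P.δ)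
    (hf : IsNonlinearity f k₀ θ) {r : ℝ} (hr : 0 ≤ r) :
    ∃ (B : BilForm State) (N : ℝ) (q : State → ℝ), Continuous q ∧
      (∀ U V, OperatorGraph P U V → B U V + B V U ≤ q U) ∧
      (∀ U : State, U.normSq + potential f U.φ ≤ B U U + N * potential f U.φ) ∧
      (∃ c > 0, ∀ U : State,
        B U U + N * potential f U.φ ≤ c * (U.normSq + potential f U.φ)) ∧
      ∃ γ > 0, ∀ S G U, Solution P f S G U → ∀ t, 0 ≤ t → ‖(U t).φx‖ ≤ r →
        q (U t) + B (U t) (G t) + B (G t) (U t) + N * ⟪nonlin P G t, (U t).ψ⟫_ℝ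
          ≤ -(2 * γ) * (B (U t) (U t) + N * potential f (U t).φ) := by
  obtain ⟨c₀, hc₀, hcoer⟩ := exists_le_energyForm hP
  set K := 2 * k₀ * r ^ θ with hK
  have hk₀ := hf.hk₀
  have hK0 : 0 ≤ K := by positivity
  obtain ⟨a, ha, hLyap⟩ := exists_lyapForm_deriv_le hP hlt hspeed
  obtain ⟨C₁, hC₁, hY₁⟩ := exists_mul_inner_le (F := L2) (-P.b) (half_pos ha)
  obtain ⟨C₂, hC₂, hY₂⟩ := exists_mul_inner_le (F := L2) (-(12 * P.δ)) one_pos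
  obtain ⟨N₀, hN₀, N₁, hN₁, hLyap⟩ := hLyap ((C₁ + C₂) * K ^ 2 + 2) (by positivity)
  obtain ⟨C₃, -, hC₃⟩ := exists_abs_form_le (N₁ • phiForm P + auxForm P)
  -- `N` is taken so large that the functional dominates the energy norm
  obtain ⟨N, hNN₀, hN1, hNc⟩ : ∃ N : ℝ, N₀ ≤ N ∧ 1 ≤ N ∧ C₃ + 1 ≤ N * c₀ :=
    ⟨max N₀ (max 1 ((C₃ + 1) / c₀)), le_max_left _ _, (le_max_left _ _).trans (le_max_right _ _), by
      rw [← div_le_iff₀ hc₀]; exact (le_max_right _ _).trans (le_max_right _ _)⟩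
  obtain ⟨C₄, hC₄0, hC₄⟩ := exists_abs_form_le (lyapForm P N N₁)
  have hup : ∀ U : State, lyapForm P N N₁ U U + N * potential f U.φ
      ≤ (C₄ + N) * (U.normSq + potential f U.φ) := by
    intro U
    have h1 := (abs_le.1 (hC₄ U)).2
    have h2 := mul_nonneg hC₄0 (hf.potential_nonneg U.φ)
    have h3 := mul_nonneg (by linarith : (0 : ℝ) ≤ N) U.normSq_nonneg
    linarith
  have hc₂0 : 0 < C₄ + N := by linarith
  have hγ₂0 : 0 < min (a / 2) (min 1 N₁) := by positivity
  refine ⟨lyapForm P N N₁, N, fun V => -a * (‖V.ux‖ ^ 2 + ‖V.v‖ ^ 2 + ‖V.z‖ ^ 2 + ‖V.ψ‖ ^ 2)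
    - ((C₁ + C₂) * K ^ 2 + 2) * ‖V.φx‖ ^ 2, ?_, hLyap N hNN₀, ?_, ⟨C₄ + N, hc₂0, hup⟩,
    min (a / 2) (min 1 N₁) / (C₄ + N) / 2, by positivity, ?_⟩
  · have c1 : Continuous fun V : State => ‖V.ux‖ := uxL.continuous.norm
    have c2 : Continuous fun V : State => ‖V.v‖ := vL.continuous.norm
    have c3 : Continuous fun V : State => ‖V.z‖ := zL.continuous.norm
    have c4 : Continuous fun V : State => ‖V.ψ‖ := ψL.continuous.norm
    have c5 : Continuous fun V : State => ‖V.φx‖ := φxL.continuous.norm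
    exact (continuous_const.mul ((((c1.pow 2).add (c2.pow 2)).add (c3.pow 2)).add (c4.pow 2))).sub
      (continuous_const.mul (c5.pow 2))
  · intro U
    have h1 := mul_le_mul_of_nonneg_left (hcoer U) (by linarith : (0 : ℝ) ≤ N)
    have h2 := (abs_le.1 (hC₃ U)).1
    have h3 : lyapForm P N N₁ U U
        = N * energyForm P U U + (N₁ • phiForm P + auxForm P) U U := by
      simp only [lyapForm, add_apply, smul_apply, smul_eq_mul]; ring
    have h4 := mul_le_mul_of_nonneg_right hNc U.normSq_nonneg
    have h5 := mul_le_mul_of_nonneg_right hN1 (hf.potential_nonneg U.φ)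
    rw [h3]
    linarith
  · intro S G U hU x hx0 hφx
    have hae := (U x).ae_abs_φ_le hφx
    have hF := hU.nonlin_ae hP hx0
    have hFn : ‖nonlin P G x‖ ^ 2 ≤ K ^ 2 * ‖(U x).φx‖ ^ 2 := by
      rw [← mul_pow]
      have := (hf.norm_le hae hF).trans (mul_le_mul_of_nonneg_left (U x).norm_φ_le hK0)
      gcongr
    have h1 := hU.lyapForm_forcing N N₁ hx0
    have h2 := mul_le_mul_of_nonneg_left (hf.potential_le_inner hae hF) hN₁.le
    have h3 := hY₁ (nonlin P G x) (U x).ux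
    have h4 := hY₂ (nonlin P G x) (weightL (U x).φx)
    have h5 : ‖weightL (U x).φx‖ ^ 2 ≤ ‖(U x).φx‖ ^ 2 := by gcongr; exact norm_weightL_le _
    have h6 := mul_le_mul_of_nonneg_left hFn hC₁
    have h7 := mul_le_mul_of_nonneg_left hFn hC₂
    have g1 : min (a / 2) (min 1 N₁) ≤ a / 2 := min_le_left _ _
    have g2 : min (a / 2) (min 1 N₁) ≤ 1 := (min_le_right _ _).trans (min_le_left _ _)
    have g3 : min (a / 2) (min 1 N₁) ≤ N₁ := (min_le_right _ _).trans (min_le_right _ _)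
    generalize min (a / 2) (min 1 N₁) = γ₂ at *
    have h8 : 2 * (γ₂ / (C₄ + N) / 2) * (lyapForm P N N₁ (U x) (U x) + N * potential f (U x).φ)
        ≤ γ₂ * ((U x).normSq + potential f (U x).φ) := by
      calc 2 * (γ₂ / (C₄ + N) / 2) * (lyapForm P N N₁ (U x) (U x) + N * potential f (U x).φ)
          ≤ 2 * (γ₂ / (C₄ + N) / 2) * ((C₄ + N) * ((U x).normSq + potential f (U x).φ)) := by
            gcongr; exact hup _
        _ = γ₂ * ((U x).normSq + potential f (U x).φ) := by field_simp
    have m1 := mul_le_mul_of_nonneg_right g1 (sq_nonneg ‖(U x).ux‖)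
    have m2 := mul_le_mul_of_nonneg_right g1 (sq_nonneg ‖(U x).v‖)
    have m3 := mul_le_mul_of_nonneg_right g2 (sq_nonneg ‖(U x).φx‖)
    have m4 := mul_le_mul_of_nonneg_right g1 (sq_nonneg ‖(U x).ψ‖)
    have m5 := mul_le_mul_of_nonneg_right g1 (sq_nonneg ‖(U x).z‖)
    have m6 := mul_le_mul_of_nonneg_right g3 (hf.potential_nonneg (U x).φ)
    have m7 := mul_nonneg ha.le (sq_nonneg ‖(U x).v‖)
    have m8 := mul_nonneg ha.le (sq_nonneg ‖(U x).ψ‖)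
    have m9 := mul_nonneg ha.le (sq_nonneg ‖(U x).z‖)
    unfold State.normSq at h8
    linear_combination h1 + h2 + h3 + h4 + h5 + h6 + h7 + h8 + m1 + m2 + m3 + m4 + m5 + m6
      + m7 / 2 + m8 / 2 + m9 / 2

/-- Exponential decay from any time at which the energy is at most `R`, with constants that depend
on the solution only through `R`. -/
lemma exists_decay (hP : P.Admissible) (hlt : P.μ₂ < P.μ₁) (hspeed : P.ρ / P.μ = P.J / P.δ)
    (hf : IsNonlinearity f k₀ θ) {R : ℝ} (hR : 0 < R) :
    ∃ γ > 0, ∃ M > 0, ∀ S G U, Solution P f S G U → ∀ T, 0 ≤ T → totalEnergy P f (U T) ≤ R →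
      ∀ t, T ≤ t → totalEnergy P f (U t) ≤ M * Real.exp (-γ * (t - T)) := by
  obtain ⟨c₀, hc₀, hcoer⟩ := exists_le_energyForm hP
  obtain ⟨B, N, q, hq, hBq, hlow, ⟨c₂, hc₂0, hup⟩, γ, hγ0, hdiss⟩ :=
    exists_lyapunov hP hlt hspeed hf (Real.sqrt_nonneg (R / c₀))
  obtain ⟨C, hC0, hC⟩ := exists_abs_form_le (energyForm P)
  set M₀ := c₂ * (R / c₀ + R) + 1 with hM₀
  have hM₀0 : 0 < M₀ := by positivity
  refine ⟨γ, hγ0, (C + 1) * M₀, by positivity, ?_⟩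
  intro S G U hU T hT hTR t htT
  have hpot : ∀ x, 0 ≤ potential f (U x).φ := fun x => hf.potential_nonneg _
  have henergy : ∀ x, T ≤ x → (U x).normSq ≤ R / c₀ ∧ potential f (U x).φ ≤ R := by
    intro x hx
    have h1 := (hU.totalEnergy_le hP hlt hf hT hx).trans hTR
    have h2 := hcoer (U x)
    have h3 := mul_nonneg hc₀.le (U x).normSq_nonneg
    have h4 := hpot x
    unfold totalEnergy at h1
    refine ⟨?_, by linarith⟩
    rw [le_div_iff₀ hc₀]
    linarith
  have hφx : ∀ x, T ≤ x → ‖(U x).φx‖ ≤ √(R / c₀) := by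
    intro x hx
    refine Real.le_sqrt_of_sq_le (le_trans ?_ (henergy x hx).1)
    unfold State.normSq
    linarith [sq_nonneg ‖(U x).ux‖, sq_nonneg ‖(U x).v‖, sq_nonneg ‖(U x).ψ‖,
      sq_nonneg ‖(U x).z‖]
  have hcont : ContinuousOn (fun x => B (U x) (U x) + N * potential f (U x).φ) (Icc T t) :=
    ((hU.continuousOn_form B).add (continuousOn_const.mul (hU.continuousOn_potential hf hP))).mono
      fun x hx => hT.trans hx.1
  have hstart : B (U T) (U T) + N * potential f (U T).φ ≤ M₀ * Real.exp (-γ * (T - T)) := by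
    have h1 := hup (U T)
    have h2 := henergy T le_rfl
    have h3 : c₂ * ((U T).normSq + potential f (U T).φ) ≤ c₂ * (R / c₀ + R) := by
      gcongr
      · exact h2.1
      · exact h2.2
    simp only [sub_self, mul_zero, Real.exp_zero, mul_one]
    linarith
  have hexp : ∀ x, HasDerivAt (fun x => M₀ * Real.exp (-γ * (x - T)))
      (-γ * (M₀ * Real.exp (-γ * (x - T)))) x := by
    intro x
    have h1 : HasDerivAt (fun x => -γ * (x - T)) (-γ * 1) x :=
      ((hasDerivAt_id x).sub_const T).const_mul (-γ)
    exact ((h1.exp).const_mul M₀).congr_deriv (by ring)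
  have hfence : B (U t) (U t) + N * potential f (U t).φ ≤ M₀ * Real.exp (-γ * (t - T)) := by
    refine image_le_of_liminf_slope_right_lt_deriv_boundary hcont
      (fun x hx c hc => hU.frequently_slope_lt hP hf B q hq hBq N (hT.trans hx.1) hc)
      hstart hexp ?_ (right_mem_Icc.2 htT)
    intro x hx hxB
    refine (hdiss S G U hU x (hT.trans hx.1) (hφx x hx.1)).trans_lt ?_
    rw [hxB]
    have : 0 < γ * (M₀ * Real.exp (-γ * (x - T))) := by positivity
    linarith
  have h1 := (abs_le.1 (hC (U t))).2
  have h2 := hlow (U t)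
  have h3 := mul_nonneg hC0 (hpot t)
  have h4 := (U t).normSq_nonneg
  calc totalEnergy P f (U t)
      ≤ (C + 1) * ((U t).normSq + potential f (U t).φ) := by
        unfold totalEnergy; linarith [hpot t]
    _ ≤ (C + 1) * (M₀ * Real.exp (-γ * (t - T))) := by gcongr; exact h2.trans hfence
    _ = (C + 1) * M₀ * Real.exp (-γ * (t - T)) := by ring

end Solution

end

end Porous

theorem theorem2
    (P : Porous.Coeffs) (hP : P.Admissible)
    (f : ℝ → ℝ) (k₀ θ : ℝ) (hk₀ : 0 < k₀) (hθ : 0 < θ)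
    (hgrowth : ∀ x y : ℝ, |f x - f y| ≤ k₀ * (|x| ^ θ + |y| ^ θ) * |x - y|)
    (hsign : ∀ x : ℝ, 0 ≤ Porous.primitive f x ∧ Porous.primitive f x ≤ f x * x)
    (hμ : P.μ₂ < P.μ₁)
    (hspeed : P.ρ / P.μ = P.J / P.δ)
    (η : ℝ) (hη : 0 < η) (hη₁ : P.τ * P.μ₂ ≤ η) (hη₂ : η ≤ P.τ * (2 * P.μ₁ - P.μ₂)) :
    ∃ γ : ℝ, 0 < γ ∧
      ∀ U : ℝ → Porous.State, Porous.IsMildSolution P f U →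
        ∃ C : ℝ, 0 < C ∧
          ∀ t : ℝ, 0 ≤ t →
            Porous.energy P f η (U t) ≤ C * Real.exp (-γ * t) := by
  have hf : Porous.IsNonlinearity f k₀ θ := ⟨hk₀, hθ, hgrowth, hsign⟩
  obtain ⟨c₀, hc₀, hcoer⟩ := Porous.exists_le_energyForm hP
  -- the rate is the one valid once the energy has dropped below `1`
  obtain ⟨γ, hγ, M, hM, hdecay⟩ := Porous.Solution.exists_decay hP hμ hspeed hf one_pos
  refine ⟨γ, hγ, fun U hU => ?_⟩
  obtain ⟨S, G, hsol⟩ := hU.exists_solution hP hf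
  have hnonneg : ∀ t, 0 ≤ Porous.totalEnergy P f (U t) := by
    intro t
    have h1 := hcoer (U t)
    have h2 := mul_nonneg hc₀.le (U t).normSq_nonneg
    have h3 := hf.potential_nonneg (U t).φ
    unfold Porous.totalEnergy
    linarith
  set R := Porous.totalEnergy P f (U 0) + 1 with hR
  have hR0 : 0 < R := by have := hnonneg 0; linarith
  obtain ⟨γR, hγR, MR, hMR, hdecayR⟩ := Porous.Solution.exists_decay hP hμ hspeed hf hR0
  obtain ⟨T, hT, hTsmall⟩ : ∃ T, 0 ≤ T ∧ MR * Real.exp (-γR * (T - 0)) ≤ 1 := by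
    refine ⟨max 0 (Real.log MR / γR), le_max_left _ _, ?_⟩
    have h1 : Real.log MR ≤ γR * max 0 (Real.log MR / γR) := by
      rw [← div_le_iff₀' hγR]; exact le_max_right _ _
    calc MR * Real.exp (-γR * (max 0 (Real.log MR / γR) - 0))
        = Real.exp (Real.log MR - γR * max 0 (Real.log MR / γR)) := by
          rw [sub_zero, sub_eq_add_neg, Real.exp_add, Real.exp_log hMR, neg_mul]
      _ ≤ 1 := by rw [Real.exp_le_one_iff]; linarith
  have hT1 : Porous.totalEnergy P f (U T) ≤ 1 :=
    (hdecayR S G U hsol 0 le_rfl (by linarith) T hT).trans hTsmall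
  set D := (R + M) * Real.exp (γ * T) with hD
  have hD0 : 0 < D := by positivity
  have htotal : ∀ t, 0 ≤ t → Porous.totalEnergy P f (U t) ≤ D * Real.exp (-γ * t) := by
    intro t ht
    have e : D * Real.exp (-γ * t) = (R + M) * Real.exp (-γ * (t - T)) := by
      rw [hD, mul_assoc, ← Real.exp_add]; congr 2; ring
    rw [e]
    rcases le_total t T with h | h
    · have h1 := hsol.totalEnergy_le hP hμ hf le_rfl ht
      have h2 : 1 ≤ Real.exp (-γ * (t - T)) := by
        rw [Real.one_le_exp_iff]
        nlinarith
      have h3 : R + M ≤ (R + M) * Real.exp (-γ * (t - T)) :=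
        le_mul_of_one_le_right (by positivity) h2
      linarith
    · have h1 := hdecay S G U hsol T hT hT1 t h
      have h2 : 0 ≤ R * Real.exp (-γ * (t - T)) := by positivity
      linarith
  -- changing the weight `η` of the delay variable costs at most a constant factor
  set κ := |η - P.τ * P.μ₁| / (2 * c₀) with hκ
  have hκ0 : 0 ≤ κ := by positivity
  refine ⟨(1 + κ) * D, by positivity, fun t ht => ?_⟩
  have h1 : (η - P.τ * P.μ₁) / 2 * ‖(U t).z‖ ^ 2 ≤ κ * Porous.totalEnergy P f (U t) := by
    have h2 := hcoer (U t)
    have h3 := hf.potential_nonneg (U t).φ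
    have h4 : ‖(U t).z‖ ^ 2 ≤ (U t).normSq := by
      unfold Porous.State.normSq
      nlinarith [sq_nonneg ‖(U t).ux‖, sq_nonneg ‖(U t).v‖, sq_nonneg ‖(U t).ψ‖,
        sq_nonneg ‖(U t).φx‖]
    have h5 : c₀ * ‖(U t).z‖ ^ 2 ≤ Porous.totalEnergy P f (U t) := by
      have := mul_le_mul_of_nonneg_left h4 hc₀.le
      unfold Porous.totalEnergy
      linarith
    calc (η - P.τ * P.μ₁) / 2 * ‖(U t).z‖ ^ 2 ≤ |η - P.τ * P.μ₁| / 2 * ‖(U t).z‖ ^ 2 := by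
          gcongr; exact le_abs_self _
      _ = κ * (c₀ * ‖(U t).z‖ ^ 2) := by rw [hκ]; field_simp
      _ ≤ κ * Porous.totalEnergy P f (U t) := by gcongr
  rw [Porous.energy_eq hf]
  have h2 := mul_le_mul_of_nonneg_left (htotal t ht) (by positivity : 0 ≤ 1 + κ)
  linarith
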